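/- Let $k\ge 2$ be an integer and let $\Omega\subset\mathbb R^2$ be a bounded domain whose boundary $\Gamma$ is of class $C^k$. **Meshes.** Let $\mathcal T_h$ be a finite mesh of closed nondegenerate straight triangles, any two of which either coincide or meet in nothing, a common vertex or a common edge. Let $h_T$ be the diameter of $T$, $\rho_T$ the diameter of the largest disc contained in $T$, $h=\max_T h_T$, $\Omega_h=\bigcup_{T\in\mathcal T_h}T$ and $\Gamma_h=\partial\Omega_h$. Assume that the mesh vertices on $\Gamma_h$ lie on $\Gamma$ and that no triangle has more than one edge on $\Gamma_h$. Let $\mathcal S_h$ be the set of triangles having one edge $e_T$ on $\Gamma_h$; for $T\in\mathcal S_h$ let $O_T$ be the vertex opposite to $e_T$ and let the skin $\Delta_T$ be the closed set delimited by $e_T$ and $\Gamma$, that is, the union of the segments joining the points $x$ of $e_T$ to $\Gamma$ (to the intersection nearest to $x$) along the perpendicular to $e_T$ at $x$. Put $T'=T\cup\Delta_T$ if $\Delta_T\not\subset T$ and $T'=\overline{T\setminus\Delta_T}$ otherwise. Assume that the mesh fits $\Omega$: $\overline\Omega$ is the union of the sets $T'$, $T\in\mathcal S_h$, and of the triangles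 $T\in\mathcal T_h\setminus\mathcal S_h$. **Spaces.** $V_h$ is the space of the continuous functions on $\Omega_h$ that vanish on $\Gamma_h$ and are polynomials of degree at most $k$ on every $T\in\mathcal T_h$, extended by zero outside $\Omega_h$. $W_h$ is the space of the functions $w$ that are continuous on $\Omega_h$, vanish at the mesh vertices on $\Gamma_h$, coincide on every $T\in\mathcal T_h$ with a polynomial of degree at most $k$, which for $T\in\mathcal S_h$ also defines $w$ on $\Delta_T$, and are such that for every $T\in\mathcal S_h$ this polynomial vanishes at the $k-1$ points $P\in\Gamma$ obtained as follows: for each of the $k-1$ points $M$ dividing $e_T$ into $k$ equal segments, $P$ is the intersection of $\Gamma$ with the line through $O_T$ and $M$ that is nearest to $M$. Let $$a_h(w,v)=\int_{\Omega_h}\nabla w\cdot\nabla v,\qquad \|\nabla w\|_0=\Big(\int_\Omega|\nabla w|^2\Big)^{1/2}.$$ **Claim.** For every $\sigma$ there are constants $h_0>0$ and $\alpha'>0$, depending only on $\Omega$, $k$ and $\sigma$, such that for every such mesh with $h_T\le\sigma\rho_T$ for all $T\in\mathcal T_h$ and $h\le h_0$, and for every $w\in W_h\setminus\{0\}$, $$\sup_{v\in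 V_h\setminus\{0\}}\frac{a_h(w,v)}{\|\nabla w\|_0\,\|\nabla v\|_0}\ \ge\ \alpha' .$$ -/

import Mathlib

open Set

noncomputable section

namespace CurvedFEM

/-- The Euclidean plane. -/
abbrev Plane : Type := EuclideanSpace ℝ (Fin 2)

/-- The boundary of `Ω` is of class `C^k`: near each of its boundary points, in suitable orthonormal
coordinates, `Ω` is the strict epigraph of a `C^k` function. -/
def HasCkBoundary (k : ℕ) (Ω : Set Plane) : Prop :=
  ∀ x ∈ frontier Ω, ∃ r : ℝ, 0 < r ∧ ∃ L : Plane ≃ₗᵢ[ℝ] Plane, ∃ φ : ℝ → ℝ, ContDiff ℝ k φ ∧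
    ∀ y ∈ Metric.ball x r, y ∈ Ω ↔ φ (L y 0) < L y 1

/-- The points of `A` that are nearest to `x`. -/
def nearestPts (x : Plane) (A : Set Plane) : Set Plane :=
  {y | y ∈ A ∧ ∀ z ∈ A, dist x y ≤ dist x z}

/-- The closed triangle (or edge) with the given vertices. -/
def hull (T : Finset Plane) : Set Plane := convexHull ℝ (T : Set Plane)

/-- A finite mesh of nondegenerate straight triangles, each given by its three vertices, with the
usual compatibility condition: two triangles meet in the hull of their common vertices, that is,
in nothing, a common vertex, a common edge, or they coincide. -/
structure Triangulation where
  elems : Finset (Finset Plane)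
  card_eq : ∀ T ∈ elems, T.card = 3
  indep : ∀ T ∈ elems, AffineIndependent ℝ (fun a : T => (a : Plane))
  inter_eq : ∀ T ∈ elems, ∀ T' ∈ elems,
    hull T ∩ hull T' = convexHull ℝ ((T : Set Plane) ∩ (T' : Set Plane))

namespace Triangulation

variable (𝒯 : Triangulation)

/-- The closed polygon `Ω_h`, union of the triangles. Its boundary `Γ_h` is `frontier 𝒯.polygon`. -/
def polygon : Set Plane := ⋃ T ∈ 𝒯.elems, hull T

/-- The mesh size `h`, the largest diameter of a triangle. -/
def meshSize : ℝ := ⨆ T : 𝒯.elems, Metric.diam (hull T.1)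

/-- Shape regularity `h_T ≤ σ ρ_T` for every triangle `T`, where `h_T` is the diameter of `T` and
`ρ_T` the diameter of the largest disc contained in `T`. -/
def ShapeRegular (σ : ℝ) : Prop :=
  ∀ T ∈ 𝒯.elems, ∃ c : Plane, ∃ r : ℝ, 0 < r ∧ Metric.closedBall c r ⊆ hull T ∧
    Metric.diam (hull T) ≤ σ * (2 * r)

/-- `T` is the triangle with vertices `a`, `b`, `o`, and its edge `[a, b]` lies on `Γ_h`. Thus
`T` belongs to `S_h`, `e_T = [a, b]` and `O_T = o`. -/
def BoundaryTriple (T : Finset Plane) (a b o : Plane) : Prop :=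
  T ∈ 𝒯.elems ∧ a ≠ b ∧ a ≠ o ∧ b ≠ o ∧ (T : Set Plane) = {a, b, o} ∧
    segment ℝ a b ⊆ frontier 𝒯.polygon

/-- `T` belongs to `S_h`: it has an edge on `Γ_h`. -/
def IsBoundary (T : Finset Plane) : Prop := ∃ a b o, 𝒯.BoundaryTriple T a b o

/-- The skin `Δ_T` of a boundary triangle `T`, that is, the closed set between the edge `e_T` and
the curve `Γ = frontier Ω`. It consists of the segments that join the points `x` of `e_T` to `Γ`
along the perpendicular to `e_T` at `x` (to the intersection with `Γ` nearest to `x`). On a fine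
mesh, `Γ` is a graph over `e_T` near `e_T`, and this is the closed set delimited by `e_T` and the
arc of `Γ` with the same end points. It is empty if `T` has no edge on `Γ_h`. -/
def skin (Ω : Set Plane) (T : Finset Plane) : Set Plane :=
  {z | ∃ a b o, 𝒯.BoundaryTriple T a b o ∧ ∃ x ∈ segment ℝ a b,
    ∃ y ∈ nearestPts x (frontier Ω ∩ {y | inner ℝ (y - x) (b - a) = 0}), z ∈ segment ℝ x y}

open Classical in
/-- The curved element `T'`: for `T ∈ S_h` it is `T ∪ Δ_T` if `Δ_T` is not a subset of `T`, and the
closure of `T \ Δ_T` otherwise; for the other triangles it is `T` itself. -/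
def curvedElem (Ω : Set Plane) (T : Finset Plane) : Set Plane :=
  if 𝒯.IsBoundary T then
    if 𝒯.skin Ω T ⊆ hull T then closure (hull T \ 𝒯.skin Ω T) else hull T ∪ 𝒯.skin Ω T
  else hull T

/-- The mesh fits `Ω`. -/
structure Fits (Ω : Set Plane) : Prop where
  /-- The mesh vertices on `Γ_h` lie on `Γ`. -/
  vertex_mem : ∀ T ∈ 𝒯.elems, ∀ a ∈ T, a ∈ frontier 𝒯.polygon → a ∈ frontier Ω
  /-- No triangle has more than one edge on `Γ_h`. -/
  one_edge : ∀ T a b o a' b' o', 𝒯.BoundaryTriple T a b o → 𝒯.BoundaryTriple T a' b' o' →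
    o = o'
  /-- The (curved) elements make up `Ω`. -/
  iUnion_curvedElem : ⋃ T ∈ 𝒯.elems, 𝒯.curvedElem Ω T = closure Ω

/-- The nodes `P ∈ Γ` of `T ∈ S_h`: for each of the `k - 1` points `M` different from `a`, `b` that
divide `e_T = [a, b]` into `k` equal segments, the intersection of `Γ` with the line through `O_T`
and `M` that is nearest to `M`. There is none if `T` has no edge on `Γ_h`. -/
def boundaryNodes (k : ℕ) (Ω : Set Plane) (T : Finset Plane) : Set Plane :=
  {P | ∃ a b o, 𝒯.BoundaryTriple T a b o ∧ ∃ j : ℕ, 1 ≤ j ∧ j ≤ k - 1 ∧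
    P ∈ nearestPts (AffineMap.lineMap a b ((j : ℝ) / (k : ℝ)))
      (frontier Ω ∩ (line[ℝ, o, AffineMap.lineMap a b ((j : ℝ) / (k : ℝ))] : Set Plane))}

end Triangulation

/-- The value at a point of the plane of a polynomial in two variables. -/
def polyVal (p : MvPolynomial (Fin 2) ℝ) (x : Plane) : ℝ := MvPolynomial.eval (fun i => x i) p

namespace Triangulation

variable (𝒯 : Triangulation)

/-- The space `V_h`: continuous functions on `Ω_h` that vanish on `Γ_h` and are polynomials of
degree at most `k` on every triangle, extended by zero outside `Ω_h`. -/
def spaceV (k : ℕ) : Submodule ℝ (Plane → ℝ) where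
  carrier := {v | ContinuousOn v 𝒯.polygon ∧ (∀ x ∈ frontier 𝒯.polygon, v x = 0) ∧
    (∀ x ∉ 𝒯.polygon, v x = 0) ∧
    ∀ T ∈ 𝒯.elems, ∃ p : MvPolynomial (Fin 2) ℝ, p.totalDegree ≤ k ∧
      ∀ x ∈ hull T, v x = polyVal p x}
  zero_mem' := ⟨continuousOn_const, fun _ _ => rfl, fun _ _ => rfl,
    fun _ _ => ⟨0, by simp, by simp [polyVal]⟩⟩
  add_mem' := by
    rintro v w ⟨hv₁, hv₂, hv₃, hv₄⟩ ⟨hw₁, hw₂, hw₃, hw₄⟩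
    refine ⟨hv₁.add hw₁, fun x hx => by simp [hv₂ x hx, hw₂ x hx],
      fun x hx => by simp [hv₃ x hx, hw₃ x hx], fun T hT => ?_⟩
    obtain ⟨p, hp, hp'⟩ := hv₄ T hT
    obtain ⟨q, hq, hq'⟩ := hw₄ T hT
    exact ⟨p + q, (MvPolynomial.totalDegree_add p q).trans (max_le hp hq),
      fun x hx => by simp [hp' x hx, hq' x hx, polyVal]⟩
  smul_mem' := by
    rintro c v ⟨hv₁, hv₂, hv₃, hv₄⟩
    refine ⟨hv₁.const_smul c, fun x hx => by simp [hv₂ x hx],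
      fun x hx => by simp [hv₃ x hx], fun T hT => ?_⟩
    obtain ⟨p, hp, hp'⟩ := hv₄ T hT
    exact ⟨c • p, (MvPolynomial.totalDegree_smul_le c p).trans hp,
      fun x hx => by simp [hp' x hx, polyVal, MvPolynomial.smul_eval]⟩

/-- The space `W_h`: functions that are continuous on `Ω_h`, vanish at the mesh vertices on `Γ_h`,
and are given on every triangle `T` by a polynomial of degree at most `k`; for `T ∈ S_h` this
polynomial also gives the function on the skin `Δ_T`, and it vanishes at the nodes `P ∈ Γ` of `T`.
(For `T ∉ S_h` the skin and the set of nodes are empty.) The value of the function at the points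
where it is not defined, those outside `Ω_h` and the skins, is set to zero. -/
def spaceW (k : ℕ) (Ω : Set Plane) : Submodule ℝ (Plane → ℝ) where
  carrier := {w | ContinuousOn w 𝒯.polygon ∧
    (∀ T ∈ 𝒯.elems, ∀ a ∈ T, a ∈ frontier 𝒯.polygon → w a = 0) ∧
    (∀ x, (∀ T ∈ 𝒯.elems, x ∉ hull T ∪ 𝒯.skin Ω T) → w x = 0) ∧
    ∀ T ∈ 𝒯.elems, ∃ p : MvPolynomial (Fin 2) ℝ, p.totalDegree ≤ k ∧
      (∀ x ∈ hull T ∪ 𝒯.skin Ω T, w x = polyVal p x) ∧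
      ∀ P ∈ 𝒯.boundaryNodes k Ω T, polyVal p P = 0}
  zero_mem' := ⟨continuousOn_const, fun _ _ _ _ _ => rfl, fun _ _ => rfl,
    fun _ _ => ⟨0, by simp, by simp [polyVal], by simp [polyVal]⟩⟩
  add_mem' := by
    rintro v w ⟨hv₁, hv₂, hv₃, hv₄⟩ ⟨hw₁, hw₂, hw₃, hw₄⟩
    refine ⟨hv₁.add hw₁, fun T hT a ha h => by simp [hv₂ T hT a ha h, hw₂ T hT a ha h],
      fun x hx => by simp [hv₃ x hx, hw₃ x hx], fun T hT => ?_⟩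
    obtain ⟨p, hp, hp', hp''⟩ := hv₄ T hT
    obtain ⟨q, hq, hq', hq''⟩ := hw₄ T hT
    refine ⟨p + q, (MvPolynomial.totalDegree_add p q).trans (max_le hp hq),
      fun x hx => ?_, fun P hP => ?_⟩
    · rw [Pi.add_apply, hp' x hx, hq' x hx]
      simp [polyVal]
    · have h₁ := hp'' P hP
      have h₂ := hq'' P hP
      simp only [polyVal] at h₁ h₂
      simp [polyVal, h₁, h₂]
  smul_mem' := by
    rintro c v ⟨hv₁, hv₂, hv₃, hv₄⟩
    refine ⟨hv₁.const_smul c, fun T hT a ha h => by simp [hv₂ T hT a ha h],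
      fun x hx => by simp [hv₃ x hx], fun T hT => ?_⟩
    obtain ⟨p, hp, hp', hp''⟩ := hv₄ T hT
    refine ⟨c • p, (MvPolynomial.totalDegree_smul_le c p).trans hp,
      fun x hx => ?_, fun P hP => ?_⟩
    · rw [Pi.smul_apply, hp' x hx]
      simp [polyVal, MvPolynomial.smul_eval]
    · have h₁ := hp'' P hP
      simp only [polyVal] at h₁
      simp [polyVal, MvPolynomial.smul_eval, h₁]

/-- The bilinear form `a_h(w, v) = ∫_{Ω_h} grad w · grad v`. -/
def form (w v : Plane → ℝ) : ℝ := ∫ x in 𝒯.polygon, inner ℝ (gradient w x) (gradient v x)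

end Triangulation

/-- The norm `‖grad w‖_0` in `L²(Ω)`. The functions it is used for are differentiable almost
everywhere in `Ω`. -/
def gradNorm (Ω : Set Plane) (w : Plane → ℝ) : ℝ := Real.sqrt (∫ x in Ω, ‖gradient w x‖ ^ 2)

end CurvedFEM

end

/-! The test function is `w` itself, corrected near the boundary so that it vanishes on `Γ_h`. On a
boundary triangle `T` with edge `[a, b]`, let `p` be the polynomial of `w`. It vanishes at `a`, `b`
and at the nodes on `Γ`. Since `Γ` is at least `C²`, an arc of `Γ` stays within `O(h_T²)` of its
chord, and shape regularity puts each node within `O(h_T²)` of the corresponding point `M` of the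
edge. The mean value inequality and the comparison of the sup norm of `∇p` with its `L²` norm give
`|p(M)| = O(h_T) ‖∇p‖_{L²(T)}`.

The values at the points `M` determine `p` on the edge. They are extended to a polynomial `q` of
degree at most `k` that equals `p` on `[a, b]`, vanishes on the two other edges and is bounded by
these values (`exists_edge_correction`). An inverse inequality yields `‖∇q‖²_{L²(T)} ≤ K₂ h_T²
‖∇p‖²_{L²(T)}` (`exists_small_edge_correction`), which is at most half of `‖∇p‖²_{L²(T)}` on fine
meshes. On the other triangles `q = 0`.

The polynomials `p - q` glue to some `v ∈ V_h` (`exists_spaceV_of_correction`). With `A = Σ_T ∫_T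
|∇p|²`, Young's inequality gives `a_h(w, v) ≥ A / 4`, and the parallelogram law gives `‖∇v‖_0² ≤ 3
A`. On a skin `w` is still given by `p`, and `T` with its skin lies in a disc of radius comparable
to the inradius, so `‖∇w‖_0² ≤ K A`. This gives the constant `1 / (4 √K √3)`. All constants for
polynomials come from equivalence of norms in finite dimension on the unit disc, followed by
scaling. -/

noncomputable section

namespace CurvedFEM

open MvPolynomial MeasureTheory

/-! ### Polynomials on discs: gradients, scaling, norm comparison and inverse inequalities. -/

section Polynomials

theorem polyVal_add (p q : MvPolynomial (Fin 2) ℝ) (x : Plane) :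
    polyVal (p + q) x = polyVal p x + polyVal q x := by simp [polyVal]

theorem polyVal_sub (p q : MvPolynomial (Fin 2) ℝ) (x : Plane) :
    polyVal (p - q) x = polyVal p x - polyVal q x := by simp [polyVal]

theorem polyVal_mul (p q : MvPolynomial (Fin 2) ℝ) (x : Plane) :
    polyVal (p * q) x = polyVal p x * polyVal q x := by simp [polyVal]

theorem polyVal_smul (c : ℝ) (p : MvPolynomial (Fin 2) ℝ) (x : Plane) :
    polyVal (c • p) x = c * polyVal p x := by simp [polyVal]

@[simp] theorem polyVal_zero (x : Plane) : polyVal 0 x = 0 := by simp [polyVal]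

@[simp] theorem polyVal_C (c : ℝ) (x : Plane) : polyVal (C c) x = c := by simp [polyVal]

@[simp] theorem polyVal_X (i : Fin 2) (x : Plane) : polyVal (X i) x = x i := by simp [polyVal]

@[simp] theorem polyVal_one (x : Plane) : polyVal 1 x = 1 := by simp [polyVal]

theorem continuous_polyVal (p : MvPolynomial (Fin 2) ℝ) : Continuous (polyVal p) := by
  unfold polyVal
  exact (MvPolynomial.continuous_eval p).comp (by fun_prop)

/-- The gradient of a polynomial. -/
def polyGrad (p : MvPolynomial (Fin 2) ℝ) (x : Plane) : Plane :=
  WithLp.toLp 2 fun i => polyVal (pderiv i p) x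

@[simp] theorem polyGrad_apply (p : MvPolynomial (Fin 2) ℝ) (x : Plane) (i : Fin 2) :
    polyGrad p x i = polyVal (pderiv i p) x := rfl

theorem polyGrad_sub (p q : MvPolynomial (Fin 2) ℝ) (x : Plane) :
    polyGrad (p - q) x = polyGrad p x - polyGrad q x := by
  ext i; simp [polyVal_sub]

theorem continuous_polyGrad (p : MvPolynomial (Fin 2) ℝ) : Continuous (polyGrad p) := by
  unfold polyGrad
  exact (PiLp.continuous_toLp 2 _).comp (continuous_pi fun i => continuous_polyVal _)

theorem norm_polyGrad_sq (p : MvPolynomial (Fin 2) ℝ) (x : Plane) :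
    ‖polyGrad p x‖ ^ 2 = ∑ i, polyVal (pderiv i p) x ^ 2 := by
  rw [EuclideanSpace.norm_sq_eq]
  simp

theorem hasGradientAt_polyVal (p : MvPolynomial (Fin 2) ℝ) (x : Plane) :
    HasGradientAt (polyVal p) (polyGrad p x) x := by
  rw [hasGradientAt_iff_hasFDerivAt]
  induction p using MvPolynomial.induction_on with
  | C a =>
    have h : polyVal (C a) = fun _ => a := by ext y; simp
    rw [h]
    refine (hasFDerivAt_const a x).congr_fderiv ?_
    ext y
    simp [PiLp.inner_apply]
  | add p q hp hq =>
    have h : polyVal (p + q) = polyVal p + polyVal q := by ext y; simp [polyVal_add]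
    rw [h]
    refine (hp.add hq).congr_fderiv ?_
    ext y
    simp [PiLp.inner_apply, polyVal_add]
    ring
  | mul_X p i hp =>
    have h : polyVal (p * X i) = polyVal p * (EuclideanSpace.proj i : Plane →L[ℝ] ℝ) := by
      ext y; simp [polyVal_mul]
    rw [h]
    refine (hp.mul (EuclideanSpace.proj i : Plane →L[ℝ] ℝ).hasFDerivAt).congr_fderiv ?_
    ext y
    fin_cases i <;> simp [PiLp.inner_apply, polyVal_add, polyVal_mul, pderiv_X] <;> ring

theorem differentiable_polyVal (p : MvPolynomial (Fin 2) ℝ) : Differentiable ℝ (polyVal p) :=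
  fun x => (hasGradientAt_polyVal p x).differentiableAt

theorem gradient_polyVal (p : MvPolynomial (Fin 2) ℝ) (x : Plane) :
    gradient (polyVal p) x = polyGrad p x := (hasGradientAt_polyVal p x).gradient

theorem totalDegree_pderiv_le (i : Fin 2) (p : MvPolynomial (Fin 2) ℝ) :
    (pderiv i p).totalDegree ≤ p.totalDegree := by
  conv_lhs => rw [p.as_sum, map_sum]
  refine totalDegree_finsetSum_le fun s hs => ?_
  rw [pderiv_monomial]
  refine (totalDegree_monomial_le _ _).trans (le_trans ?_ (le_totalDegree hs))
  rw [Finsupp.sum_fintype _ _ (by simp), Finsupp.sum_fintype _ _ (by simp)]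
  exact Finset.sum_le_sum fun j _ => by simp

theorem totalDegree_bind₁_le {g : Fin 2 → MvPolynomial (Fin 2) ℝ}
    (hg : ∀ i, (g i).totalDegree ≤ 1) (p : MvPolynomial (Fin 2) ℝ) :
    (bind₁ g p).totalDegree ≤ p.totalDegree := by
  conv_lhs => rw [p.as_sum, map_sum]
  refine totalDegree_finsetSum_le fun s hs => ?_
  rw [bind₁_monomial]
  refine le_trans ?_ (le_totalDegree hs)
  refine (totalDegree_mul _ _).trans ?_
  rw [totalDegree_C, zero_add]
  refine (totalDegree_finsetProd _ _).trans (Finset.sum_le_sum fun i _ => ?_)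
  exact (totalDegree_pow _ _).trans (by simpa using Nat.mul_le_mul_left _ (hg i))

/-- The polynomial `y ↦ p (c + r y)`. -/
def rescale (c : Plane) (r : ℝ) (p : MvPolynomial (Fin 2) ℝ) : MvPolynomial (Fin 2) ℝ :=
  bind₁ (fun i => C (c i) + r • X i) p

theorem totalDegree_rescale_le (c : Plane) (r : ℝ) (p : MvPolynomial (Fin 2) ℝ) :
    (rescale c r p).totalDegree ≤ p.totalDegree := by
  refine totalDegree_bind₁_le (fun i => (totalDegree_add _ _).trans ?_) p
  refine max_le (by simp) ((totalDegree_smul_le _ _).trans (by simp))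

theorem polyVal_rescale (c : Plane) (r : ℝ) (p : MvPolynomial (Fin 2) ℝ) (y : Plane) :
    polyVal (rescale c r p) y = polyVal p (c + r • y) := by
  unfold polyVal rescale
  rw [← MvPolynomial.coe_aeval_eq_eval, ← MvPolynomial.coe_aeval_eq_eval]
  simp only [RingHom.coe_coe]
  rw [MvPolynomial.aeval_bind₁]
  congr 2
  ext i
  simp [MvPolynomial.smul_eq_C_mul]

/-- The disc contains a product of two nonempty open intervals, and a polynomial vanishing on a
product of infinite sets is zero. -/
theorem eq_zero_of_polyVal_eq_zero_on_ball {p : MvPolynomial (Fin 2) ℝ} {c : Plane} {r : ℝ}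
    (hr : 0 < r) (h : ∀ x ∈ Metric.ball c r, polyVal p x = 0) : p = 0 := by
  refine MvPolynomial.funext_set (fun i => Ioo (c i - r / 2) (c i + r / 2))
    (fun i => Ioo_infinite (by linarith)) fun x hx => ?_
  have hx' := h (WithLp.toLp 2 x) ?_
  · simpa [polyVal] using hx'
  · rw [Metric.mem_ball, EuclideanSpace.dist_eq, Real.sqrt_lt' hr]
    simp only [Fin.sum_univ_two, Real.dist_eq, sq_abs]
    have h0 := hx 0 (mem_univ _)
    have h1 := hx 1 (mem_univ _)
    simp only [mem_Ioo] at h0 h1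
    nlinarith [h0.1, h0.2, h1.1, h1.2]

/-- The abstract form of equivalence of norms: `B ∘ A⁻¹` is linear on the finite-dimensional range
of `A`, hence bounded. -/
theorem exists_norm_le_of_injective {V X Y : Type*} [AddCommGroup V] [Module ℝ V]
    [FiniteDimensional ℝ V] [NormedAddCommGroup X] [NormedSpace ℝ X] [NormedAddCommGroup Y]
    [NormedSpace ℝ Y] (A : V →ₗ[ℝ] X) (hA : Function.Injective A) (B : V →ₗ[ℝ] Y) :
    ∃ C : ℝ, 0 < C ∧ ∀ v, ‖B v‖ ≤ C * ‖A v‖ := by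
  let e := LinearEquiv.ofInjective A hA
  let D : LinearMap.range A →L[ℝ] Y := LinearMap.toContinuousLinearMap (B ∘ₗ e.symm.toLinearMap)
  refine ⟨‖D‖ + 1, by positivity, fun v => ?_⟩
  have h : D (e v) = B v := by simp [D]
  have h2 : ‖e v‖ = ‖A v‖ := rfl
  rw [← h, ← h2]
  exact (D.le_opNorm _).trans (by gcongr; linarith)

theorem integrableOn_sq_polyVal (p : MvPolynomial (Fin 2) ℝ) (c : Plane) (r : ℝ) :
    IntegrableOn (fun x => polyVal p x ^ 2) (Metric.closedBall c r) :=
  ((continuous_polyVal p).pow 2).continuousOn.integrableOn_compact (isCompact_closedBall c r)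

theorem memLp_polyVal (p : MvPolynomial (Fin 2) ℝ) (c : Plane) (r : ℝ) :
    MemLp (polyVal p) 2 (volume.restrict (Metric.closedBall c r)) := by
  rw [memLp_two_iff_integrable_sq (continuous_polyVal p).aestronglyMeasurable]
  exact integrableOn_sq_polyVal p c r

/-- Polynomials as elements of `L²` of the closed unit disc. -/
def polyToLp : MvPolynomial (Fin 2) ℝ →ₗ[ℝ]
    Lp ℝ 2 (volume.restrict (Metric.closedBall (0 : Plane) 1)) where
  toFun p := (memLp_polyVal p 0 1).toLp
  map_add' p q := by
    rw [← MemLp.toLp_add]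
    exact MemLp.toLp_congr _ _ (Filter.Eventually.of_forall fun x => polyVal_add p q x)
  map_smul' c p := by
    rw [RingHom.id_apply, ← MemLp.toLp_const_smul]
    exact MemLp.toLp_congr _ _ (Filter.Eventually.of_forall fun x => polyVal_smul c p x)

theorem norm_polyToLp_sq (p : MvPolynomial (Fin 2) ℝ) :
    ‖polyToLp p‖ ^ 2 = ∫ x in Metric.closedBall (0 : Plane) 1, polyVal p x ^ 2 := by
  rw [← real_inner_self_eq_norm_sq, L2.inner_def]
  refine integral_congr_ae ?_
  filter_upwards [(memLp_polyVal p 0 1).coeFn_toLp] with x hx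
  simp only [polyToLp, LinearMap.coe_mk, AddHom.coe_mk, hx]
  simp [sq]

theorem polyToLp_injective : Function.Injective polyToLp := by
  rw [injective_iff_map_eq_zero]
  intro p hp
  have h : polyVal p =ᵐ[volume.restrict (Metric.closedBall (0 : Plane) 1)] fun _ => 0 := by
    filter_upwards [(memLp_polyVal p 0 1).coeFn_toLp,
      Lp.coeFn_zero ℝ 2 (volume.restrict (Metric.closedBall (0 : Plane) 1))] with x hx hx0
    rw [← hx]
    change (polyToLp p) x = 0
    rw [hp, hx0]
    rfl
  have h2 := Measure.eqOn_open_of_ae_eq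
    (ae_restrict_of_ae_restrict_of_subset Metric.ball_subset_closedBall h) Metric.isOpen_ball
    (continuous_polyVal p).continuousOn continuousOn_const
  exact eq_zero_of_polyVal_eq_zero_on_ball one_pos h2

/-- Polynomials as continuous functions on a compact set. -/
def polyToC (K : Set Plane) : MvPolynomial (Fin 2) ℝ →ₗ[ℝ] C(K, ℝ) where
  toFun p := ⟨fun x => polyVal p x, (continuous_polyVal p).comp continuous_subtype_val⟩
  map_add' p q := by ext x; exact polyVal_add p q x
  map_smul' c p := by ext x; exact polyVal_smul c p x

/-- Taking `D` to be the identity gives the comparison of sup and `L²` norms; taking a partial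
derivative gives the inverse inequality. -/
theorem exists_bound_of_linearMap (k : ℕ) (R : ℝ)
    (D : MvPolynomial (Fin 2) ℝ →ₗ[ℝ] MvPolynomial (Fin 2) ℝ) :
    ∃ C : ℝ, 0 < C ∧ ∀ p : MvPolynomial (Fin 2) ℝ, p.totalDegree ≤ k →
      ∀ x ∈ Metric.closedBall (0 : Plane) R,
        polyVal (D p) x ^ 2 ≤ C * ∫ y in Metric.closedBall (0 : Plane) 1, polyVal p y ^ 2 := by
  have : CompactSpace (Metric.closedBall (0 : Plane) R) :=
    isCompact_iff_compactSpace.1 (isCompact_closedBall _ _)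
  obtain ⟨C, hC, h⟩ := exists_norm_le_of_injective
    (polyToLp ∘ₗ (restrictTotalDegree (Fin 2) ℝ k).subtype)
    (polyToLp_injective.comp Subtype.val_injective)
    (polyToC (Metric.closedBall (0 : Plane) R) ∘ₗ D ∘ₗ (restrictTotalDegree (Fin 2) ℝ k).subtype)
  refine ⟨C ^ 2, by positivity, fun p hp x hx => ?_⟩
  have h1 := h ⟨p, (mem_restrictTotalDegree _ _ _).2 hp⟩
  simp only [LinearMap.comp_apply, Submodule.subtype_apply] at h1
  have h2 := (polyToC (Metric.closedBall (0 : Plane) R) (D p)).norm_coe_le_norm ⟨x, hx⟩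
  rw [← norm_polyToLp_sq, ← mul_pow]
  refine sq_le_sq' ?_ ?_
  · have := neg_abs_le (polyVal (D p) x)
    have h3 : |polyVal (D p) x| ≤ C * ‖polyToLp p‖ := h2.trans h1
    linarith
  · exact (le_abs_self _).trans (h2.trans h1)

/-- The exponent 2 is the dimension of the plane. -/
theorem setIntegral_closedBall_rescale (f : Plane → ℝ) (c : Plane) {r : ℝ} (hr : 0 < r) :
    ∫ y in Metric.closedBall (0 : Plane) 1, f (c + r • y) =
      (r ^ 2)⁻¹ * ∫ x in Metric.closedBall c r, f x := by
  have h1 := Measure.setIntegral_comp_smul_of_pos (volume : Measure Plane) (fun y => f (c + y))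
    (Metric.closedBall 0 1) hr
  rw [h1, smul_eq_mul]
  congr 1
  · simp
  · rw [smul_closedBall _ _ zero_le_one]
    have h2 := (measurePreserving_add_left (volume : Measure Plane) c).setIntegral_preimage_emb
      (measurableEmbedding_addLeft c) f (Metric.closedBall c r)
    rw [← h2]
    congr 2
    ext y
    simp [abs_of_pos hr]

/-- Sup-norm of a polynomial on a concentric larger disc in terms of its `L²`-norm on a disc. -/
theorem exists_sq_polyVal_le (k : ℕ) (R : ℝ) :
    ∃ C : ℝ, 0 < C ∧ ∀ p : MvPolynomial (Fin 2) ℝ, p.totalDegree ≤ k → ∀ (c : Plane) (r : ℝ),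
      0 < r → ∀ x ∈ Metric.closedBall c (R * r),
        polyVal p x ^ 2 * r ^ 2 ≤ C * ∫ y in Metric.closedBall c r, polyVal p y ^ 2 := by
  obtain ⟨C, hC, h⟩ := exists_bound_of_linearMap k R LinearMap.id
  refine ⟨C, hC, fun p hp c r hr x hx => ?_⟩
  have h1 := h (rescale c r p) ((totalDegree_rescale_le c r p).trans hp) (r⁻¹ • (x - c)) ?_
  · simp only [LinearMap.id_apply, polyVal_rescale] at h1
    rw [setIntegral_closedBall_rescale (fun y => polyVal p y ^ 2) c hr, smul_smul,
      mul_inv_cancel₀ hr.ne', one_smul, add_sub_cancel] at h1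
    calc _ ≤ (C * ((r ^ 2)⁻¹ * ∫ y in Metric.closedBall c r, polyVal p y ^ 2)) * r ^ 2 := by gcongr
      _ = _ := by field_simp
  · rw [mem_closedBall_zero_iff, norm_smul, norm_inv, Real.norm_of_nonneg hr.le,
      inv_mul_le_iff₀ hr, mul_comm]
    rwa [mem_closedBall_iff_norm] at hx

/-- Each partial derivative is again a polynomial of degree at most `k`, so `exists_sq_polyVal_le`
applies componentwise. -/
theorem exists_norm_polyGrad_sq_le (k : ℕ) (R : ℝ) :
    ∃ C : ℝ, 0 < C ∧ ∀ p : MvPolynomial (Fin 2) ℝ, p.totalDegree ≤ k → ∀ (c : Plane) (r : ℝ),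
      0 < r → ∀ x ∈ Metric.closedBall c (R * r),
        ‖polyGrad p x‖ ^ 2 * r ^ 2 ≤ C * ∫ y in Metric.closedBall c r, ‖polyGrad p y‖ ^ 2 := by
  obtain ⟨C, hC, h⟩ := exists_sq_polyVal_le k R
  refine ⟨C, hC, fun p hp c r hr x hx => ?_⟩
  simp only [norm_polyGrad_sq]
  rw [integral_finsetSum _ fun i _ => integrableOn_sq_polyVal _ c r, Finset.mul_sum,
    Finset.sum_mul]
  exact Finset.sum_le_sum fun i _ => h _ ((totalDegree_pderiv_le i p).trans hp) c r hr x hx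

theorem polyVal_pderiv_rescale (i : Fin 2) (c : Plane) (r : ℝ) (p : MvPolynomial (Fin 2) ℝ)
    (y : Plane) :
    polyVal (pderiv i (rescale c r p)) y = r * polyVal (pderiv i p) (c + r • y) := by
  have h1 := hasGradientAt_polyVal (rescale c r p) y
  have h2 := hasGradientAt_polyVal p (c + r • y)
  rw [hasGradientAt_iff_hasFDerivAt] at h1 h2
  have h3 : HasFDerivAt (fun z : Plane => c + r • z) (r • ContinuousLinearMap.id ℝ Plane) y :=
    ((hasFDerivAt_id y).const_smul r).const_add c
  have h4 := h2.comp y h3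
  have h5 : polyVal (rescale c r p) = polyVal p ∘ fun z : Plane => c + r • z := by
    ext z; exact polyVal_rescale c r p z
  rw [h5] at h1
  have h6 := DFunLike.congr_fun (h1.unique h4) (EuclideanSpace.single i 1)
  simpa [PiLp.inner_apply, Pi.single_apply] using h6

/-- Inverse inequality for polynomials on discs. -/
theorem exists_norm_polyGrad_sq_le_of_bound (k : ℕ) (R : ℝ) :
    ∃ C : ℝ, 0 < C ∧ ∀ p : MvPolynomial (Fin 2) ℝ, p.totalDegree ≤ k → ∀ (c : Plane) (r : ℝ),
      0 < r → ∀ B : ℝ, (∀ y ∈ Metric.closedBall c r, |polyVal p y| ≤ B) →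
        ∀ x ∈ Metric.closedBall c (R * r), ‖polyGrad p x‖ ^ 2 * r ^ 2 ≤ C * B ^ 2 := by
  choose C hC h using fun i : Fin 2 => exists_bound_of_linearMap k R (pderiv i).toLinearMap
  have hv : 0 < volume.real (Metric.closedBall (0 : Plane) 1) :=
    ENNReal.toReal_pos (Metric.measure_closedBall_pos _ _ one_pos).ne'
      measure_closedBall_lt_top.ne
  refine ⟨(∑ i, C i) * volume.real (Metric.closedBall (0 : Plane) 1),
    mul_pos (Finset.sum_pos (fun i _ => hC i) Finset.univ_nonempty) hv,
    fun p hp c r hr B hB x hx => ?_⟩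
  have hint : ∫ y in Metric.closedBall (0 : Plane) 1, polyVal (rescale c r p) y ^ 2 ≤
      volume.real (Metric.closedBall (0 : Plane) 1) * B ^ 2 := by
    calc _ ≤ ∫ y in Metric.closedBall (0 : Plane) 1, B ^ 2 := by
          refine setIntegral_mono_on (integrableOn_sq_polyVal _ _ _)
            (integrableOn_const measure_closedBall_lt_top.ne) measurableSet_closedBall
            fun y hy => ?_
          rw [polyVal_rescale]
          refine sq_le_sq.2 ((hB _ ?_).trans (le_abs_self _))
          rw [mem_closedBall_iff_norm, add_sub_cancel_left, norm_smul, Real.norm_of_nonneg hr.le]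
          rw [mem_closedBall_zero_iff] at hy
          nlinarith
      _ = _ := by simp
  rw [norm_polyGrad_sq, Finset.sum_mul, mul_assoc, Finset.sum_mul]
  refine Finset.sum_le_sum fun i _ => ?_
  have h1 := h i (rescale c r p) ((totalDegree_rescale_le c r p).trans hp) (r⁻¹ • (x - c)) ?_
  · have h2 : (pderiv i).toLinearMap (rescale c r p) = pderiv i (rescale c r p) := rfl
    rw [h2, polyVal_pderiv_rescale, smul_smul, mul_inv_cancel₀ hr.ne', one_smul, add_sub_cancel,
      mul_pow, mul_comm] at h1
    exact h1.trans (mul_le_mul_of_nonneg_left hint (hC i).le)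
  · rw [mem_closedBall_zero_iff, norm_smul, norm_inv, Real.norm_of_nonneg hr.le,
      inv_mul_le_iff₀ hr, mul_comm]
    rwa [mem_closedBall_iff_norm] at hx

end Polynomials

/-! ### Arcs of the boundary curve stay quadratically close to their chords. -/

section BoundaryCurve

/-- The error is `t` times the difference of the slopes of `g` over `[0, t]` and `[0, 1]`, both of
which are values of `g'`. -/
theorem abs_sub_interp_le {g : ℝ → ℝ} (hg : Differentiable ℝ g) {D : ℝ}
    (hD : ∀ u ∈ Icc (0 : ℝ) 1, ∀ v ∈ Icc (0 : ℝ) 1, |deriv g u - deriv g v| ≤ D) {t : ℝ}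
    (ht : t ∈ Icc (0 : ℝ) 1) : |g t - ((1 - t) * g 0 + t * g 1)| ≤ D := by
  have hD0 : 0 ≤ D := (abs_nonneg _).trans (hD t ht t ht)
  rcases ht.1.eq_or_lt with rfl | h0
  · simpa using hD0
  obtain ⟨ξ, hξ, hξ'⟩ := exists_deriv_eq_slope g h0 hg.continuous.continuousOn
    hg.differentiableOn
  obtain ⟨η, hη, hη'⟩ := exists_deriv_eq_slope g one_pos hg.continuous.continuousOn
    hg.differentiableOn
  have h1 : g t - g 0 = t * deriv g ξ := by rw [hξ']; field_simp; ring
  have h2 : g 1 - g 0 = deriv g η := by rw [hη']; simp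
  have h3 : g t - ((1 - t) * g 0 + t * g 1) = t * (deriv g ξ - deriv g η) := by
    linear_combination h1 - t * h2
  rw [h3, abs_mul, abs_of_nonneg ht.1]
  have := hD ξ ⟨hξ.1.le, hξ.2.le.trans ht.2⟩ η ⟨hη.1.le, hη.2.le⟩
  nlinarith [ht.2, abs_nonneg (deriv g ξ - deriv g η)]

/-- The points `a` and `b` are joined within `Γ` at distance at most `ε` from the chord. -/
def JoinedNearChord (Γ : Set Plane) (a b : Plane) (ε : ℝ) : Prop :=
  ∃ S : Set Plane, IsPreconnected S ∧ S ⊆ Γ ∧ a ∈ S ∧ b ∈ S ∧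
    ∀ y ∈ S, ∃ z ∈ segment ℝ a b, dist y z ≤ ε

theorem JoinedNearChord.mono {Γ : Set Plane} {a b : Plane} {ε ε' : ℝ}
    (h : JoinedNearChord Γ a b ε) (hε : ε ≤ ε') : JoinedNearChord Γ a b ε' := by
  obtain ⟨S, h1, h2, h3, h4, h5⟩ := h
  refine ⟨S, h1, h2, h3, h4, fun y hy => ?_⟩
  obtain ⟨z, hz, hyz⟩ := h5 y hy
  exact ⟨z, hz, hyz.trans hε⟩

/-- A point of the plane given by its coordinates. -/
def mk2 (s t : ℝ) : Plane := !₂[s, t]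

theorem joinedNearChord_local {k : ℕ} (hk : 2 ≤ k) {Ω : Set Plane} (hΩ : IsOpen Ω)
    (hs : HasCkBoundary k Ω) {x : Plane} (hx : x ∈ frontier Ω) :
    ∃ ε > 0, ∃ C : ℝ, 0 ≤ C ∧ ∀ a ∈ frontier Ω, ∀ b ∈ frontier Ω, dist a x < ε → dist b x < ε →
      JoinedNearChord (frontier Ω) a b (C * dist a b ^ 2) := by
  obtain ⟨r, hr, L, φ, hφ, hL⟩ := hs x hx
  -- Near `x` the frontier is exactly the graph of `φ`: a point strictly below the graph has a
  -- neighbourhood disjoint from `Ω`, and a point on the graph is a limit of points of `Ω` lying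
  -- above it.
  have hfr : ∀ y ∈ Metric.ball x r, y ∈ frontier Ω ↔ φ (L y 0) = L y 1 := by
    intro y hy
    rw [hΩ.frontier_eq]
    constructor
    · rintro ⟨h1, h2⟩
      rw [hL y hy, not_lt] at h2
      refine h2.antisymm' ?_
      by_contra! hlt
      have hopen : IsOpen {z : Plane | L z 1 < φ (L z 0)} := by
        refine isOpen_lt (by fun_prop) (hφ.continuous.comp (by fun_prop))
      obtain ⟨z, hz, hzΩ⟩ := mem_closure_iff.1 h1 _ (hopen.inter Metric.isOpen_ball) ⟨hlt, hy⟩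
      have := (hL z hz.2).1 hzΩ
      have h3 : L z 1 < φ (L z 0) := hz.1
      linarith
    · intro h
      refine ⟨?_, fun hyΩ => ((hL y hy).1 hyΩ).ne h⟩
      let f : ℝ → Plane := fun t => L.symm (L y + t • mk2 0 1)
      have hf : Continuous f := by fun_prop
      have hf0 : f 0 = y := by simp [f]
      have hev : ∀ᶠ t in nhdsWithin 0 (Ioi 0), f t ∈ Ω := by
        have h1 : ∀ᶠ t in nhdsWithin (0 : ℝ) (Ioi 0), f t ∈ Metric.ball x r :=
          (hf.tendsto' 0 y hf0).mono_left nhdsWithin_le_nhds |>.eventually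
            (Metric.isOpen_ball.mem_nhds hy)
        filter_upwards [h1, self_mem_nhdsWithin] with t ht ht0
        rw [hL _ ht]
        simp only [f, LinearIsometryEquiv.apply_symm_apply, mk2]
        simp [h] at ht0 ⊢
        exact ht0
      exact mem_closure_of_tendsto ((hf.tendsto' 0 y hf0).mono_left nhdsWithin_le_nhds) hev
  have hφ2 : ContDiff ℝ (1 + 1) φ := hφ.of_le (by norm_num; exact_mod_cast hk)
  have hφd : Differentiable ℝ φ := hφ2.differentiable (by norm_num)
  have hdφ : ContDiff ℝ 1 (deriv φ) := (contDiff_succ_iff_deriv.1 hφ2).2.2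
  -- This is where `k ≥ 2` is needed: `φ'` is `C¹`, hence locally Lipschitz, and its oscillation
  -- over the arc is of first order in the chord length.
  obtain ⟨K, U, hU, hK⟩ := (hdφ.contDiffAt (x := L x 0)).exists_lipschitzOnWith
  let γ : ℝ → Plane := fun s => L.symm (mk2 s (φ s))
  have hγ : Continuous γ := by
    refine L.symm.continuous.comp ?_
    unfold mk2
    have := hφ.continuous
    fun_prop
  have hγL : ∀ y ∈ Metric.ball x r, y ∈ frontier Ω → γ (L y 0) = y := by
    intro y hy hyΓ
    have h := (hfr y hy).1 hyΓ
    simp only [γ]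
    rw [LinearIsometryEquiv.symm_apply_eq, h]
    ext i; fin_cases i <;> simp [mk2]
  have hγx := hγL x (Metric.mem_ball_self hr) hx
  have hnear : U ∩ γ ⁻¹' Metric.ball x r ∈ nhds (L x 0) :=
    Filter.inter_mem hU (hγ.continuousAt.preimage_mem_nhds
      (by rw [hγx]; exact Metric.ball_mem_nhds x hr))
  obtain ⟨δ, hδ, hδU⟩ := Metric.mem_nhds_iff.1 hnear
  have hcoord : ∀ y z : Plane, |L y 0 - L z 0| ≤ dist y z := by
    intro y z
    rw [← L.dist_map y z, dist_eq_norm]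
    simpa using PiLp.norm_apply_le (L y - L z) 0
  refine ⟨min δ r, lt_min hδ hr, K, K.2, fun a ha b hb hax hbx => ?_⟩
  have hγa := hγL a (hax.trans_le (min_le_right _ _)) ha
  have hγb := hγL b (hbx.trans_le (min_le_right _ _)) hb
  have hsa : L a 0 ∈ Metric.ball (L x 0) δ := by
    rw [Metric.mem_ball, Real.dist_eq]
    exact (hcoord a x).trans_lt (hax.trans_le (min_le_left _ _))
  have hsb : L b 0 ∈ Metric.ball (L x 0) δ := by
    rw [Metric.mem_ball, Real.dist_eq]
    exact (hcoord b x).trans_lt (hbx.trans_le (min_le_left _ _))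
  let σ : ℝ → ℝ := fun t => (1 - t) * L a 0 + t * L b 0
  have hσ : ∀ t ∈ Icc (0 : ℝ) 1, σ t ∈ Metric.ball (L x 0) δ := fun t ht =>
    (convex_ball (L x 0) δ) hsa hsb (by linarith [ht.2]) ht.1 (by ring)
  have hσc : Continuous σ := by fun_prop
  have hσd : ∀ t, HasDerivAt σ (L b 0 - L a 0) t := by
    intro t
    have h1 := (((hasDerivAt_id t).const_sub 1).mul_const (L a 0)).add
      ((hasDerivAt_id t).mul_const (L b 0))
    exact h1.congr_deriv (by ring)
  have hσ0 : σ 0 = L a 0 := by simp [σ]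
  have hσ1 : σ 1 = L b 0 := by simp [σ]
  refine ⟨(γ ∘ σ) '' Icc 0 1, isPreconnected_Icc.image _ (hγ.comp hσc).continuousOn, ?_,
    ⟨0, by simp, by simp [hσ0, hγa]⟩, ⟨1, by simp, by simp [hσ1, hγb]⟩, ?_⟩
  · rintro _ ⟨t, ht, rfl⟩
    refine (hfr _ (hδU (hσ t ht)).2).2 ?_
    simp [γ, mk2]
  · rintro _ ⟨t, ht, rfl⟩
    -- The chord point has the same abscissa as the arc point, so their distance is the error of
    -- linear interpolation of `φ`.
    refine ⟨(1 - t) • a + t • b, ⟨1 - t, t, by linarith [ht.2], ht.1, by ring, rfl⟩, ?_⟩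
    have hg : ∀ u, HasDerivAt (φ ∘ σ) (deriv φ (σ u) * (L b 0 - L a 0)) u := fun u =>
      (hφd (σ u)).hasDerivAt.comp u (hσd u)
    have hab : |L b 0 - L a 0| ≤ dist a b := by rw [dist_comm]; exact hcoord b a
    have key := abs_sub_interp_le (g := φ ∘ σ) (D := K * dist a b ^ 2)
      (fun u => (hg u).differentiableAt) (fun u hu v hv => by
        rw [(hg u).deriv, (hg v).deriv, ← sub_mul, abs_mul]
        have h1 := hK.dist_le_mul _ (hδU (hσ u hu)).1 _ (hδU (hσ v hv)).1
        have h2 : dist (σ u) (σ v) ≤ dist a b := by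
          have : σ u - σ v = (u - v) * (L b 0 - L a 0) := by simp only [σ]; ring
          rw [Real.dist_eq, this, abs_mul]
          have h3 : |u - v| ≤ 1 := by
            rw [abs_le]; constructor <;> linarith [hu.1, hu.2, hv.1, hv.2]
          nlinarith [abs_nonneg (u - v), abs_nonneg (L b 0 - L a 0)]
        rw [Real.dist_eq] at h1
        calc _ ≤ (K * dist a b) * dist a b := by
              gcongr
              exact h1.trans (by gcongr)
          _ = _ := by ring) ht
    have hφa : φ (L a 0) = L a 1 := (hfr a (hax.trans_le (min_le_right _ _))).1 ha
    have hφb : φ (L b 0) = L b 1 := (hfr b (hbx.trans_le (min_le_right _ _))).1 hb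
    simp only [Function.comp_apply, hσ0, hσ1, hφa, hφb] at key
    refine le_trans (le_of_eq ?_) key
    rw [← L.dist_map, dist_eq_norm]
    have : L ((γ ∘ σ) t) - L ((1 - t) • a + t • b) =
        mk2 0 (φ (σ t) - ((1 - t) * L a 1 + t * L b 1)) := by
      ext i; fin_cases i <;> simp [γ, mk2, σ]
    rw [this, EuclideanSpace.norm_eq]
    simp [mk2, Real.sqrt_sq_eq_abs]

theorem exists_joinedNearChord {k : ℕ} (hk : 2 ≤ k) {Ω : Set Plane} (hΩ : IsOpen Ω)
    (hb : Bornology.IsBounded Ω) (hs : HasCkBoundary k Ω) :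
    ∃ δ > 0, ∃ C : ℝ, 0 < C ∧ ∀ a ∈ frontier Ω, ∀ b ∈ frontier Ω, dist a b < δ →
      JoinedNearChord (frontier Ω) a b (C * dist a b ^ 2) := by
  have hcpt : IsCompact (frontier Ω) :=
    Metric.isCompact_of_isClosed_isBounded isClosed_frontier
      (hb.closure.subset frontier_subset_closure)
  -- In the compactness induction the sets `s` containing `a` need not lie in the frontier, so
  -- membership in the frontier is kept as a separate hypothesis.
  suffices h : ∃ δ > 0, ∃ C : ℝ, 0 < C ∧ ∀ a ∈ frontier Ω, a ∈ frontier Ω → ∀ b ∈ frontier Ω,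
      dist a b < δ → JoinedNearChord (frontier Ω) a b (C * dist a b ^ 2) by
    obtain ⟨δ, hδ, C, hC, h⟩ := h
    exact ⟨δ, hδ, C, hC, fun a ha => h a ha ha⟩
  refine hcpt.induction_on (p := fun s => ∃ δ > 0, ∃ C : ℝ, 0 < C ∧ ∀ a ∈ s, a ∈ frontier Ω →
    ∀ b ∈ frontier Ω, dist a b < δ → JoinedNearChord (frontier Ω) a b (C * dist a b ^ 2))
    ⟨1, one_pos, 1, one_pos, by simp⟩ ?_ ?_ ?_
  · rintro s t hst ⟨δ, hδ, C, hC, h⟩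
    exact ⟨δ, hδ, C, hC, fun a ha => h a (hst ha)⟩
  · rintro s t ⟨δ, hδ, C, hC, h⟩ ⟨δ', hδ', C', hC', h'⟩
    refine ⟨min δ δ', lt_min hδ hδ', max C C', hC.trans_le (le_max_left _ _), ?_⟩
    rintro a (ha | ha) haΓ b hb hab
    · refine (h a ha haΓ b hb (hab.trans_le (min_le_left _ _))).mono ?_
      gcongr; exact le_max_left _ _
    · refine (h' a ha haΓ b hb (hab.trans_le (min_le_right _ _))).mono ?_
      gcongr; exact le_max_right _ _
  · intro x hx
    obtain ⟨ε, hε, C, hC, h⟩ := joinedNearChord_local hk hΩ hs hx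
    refine ⟨Metric.ball x (ε / 2), mem_nhdsWithin_of_mem_nhds (Metric.ball_mem_nhds x (by linarith)),
      ε / 2, by linarith, C + 1, by linarith, fun a ha haΓ b hb hab => ?_⟩
    rw [Metric.mem_ball] at ha
    refine (h a haΓ b hb (by linarith) ?_).mono (by gcongr; linarith)
    have := dist_triangle b a x
    rw [dist_comm b a] at this
    linarith

end BoundaryCurve

/-! ### Barycentric coordinates, and intersections of `Γ` with lines across an edge. -/

section Triangles

theorem affineMap_apply_eq_sum (B : AffineBasis (Fin 3) ℝ Plane) (f : Plane →ᵃ[ℝ] ℝ) (z : Plane) :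
    f z = ∑ i, B.coord i z * f (B i) := by
  have h1 : f z = f.linear z + f 0 := congrFun f.decomp z
  have h2 : ∀ i, f (B i) = f.linear (B i) + f 0 := fun i => congrFun f.decomp (B i)
  simp only [h2, mul_add, Finset.sum_add_distrib, ← Finset.sum_mul, B.sum_coord_apply_eq_one]
  rw [h1]
  conv_lhs => rw [← B.linear_combination_coord_eq_self z, map_sum]
  simp

/-- The barycentric frame of a nondegenerate triangle. -/
def triBasis {a b o : Plane} (h : AffineIndependent ℝ ![a, b, o]) : AffineBasis (Fin 3) ℝ Plane :=
  ⟨![a, b, o], h, by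
    rw [h.affineSpan_eq_top_iff_card_eq_finrank_add_one]
    simp⟩

@[simp] theorem coe_triBasis {a b o : Plane} (h : AffineIndependent ℝ ![a, b, o]) : (triBasis h : Fin 3 → Plane) = ![a, b, o] := rfl

theorem triBasis_coord {a b o : Plane} (h : AffineIndependent ℝ ![a, b, o]) (i j : Fin 3) : (triBasis h).coord i (![a, b, o] j) = if i = j then 1 else 0 :=
  (triBasis h).coord_apply i j

theorem coord_left {a b o : Plane} (h : AffineIndependent ℝ ![a, b, o]) (i : Fin 3) : (triBasis h).coord i a = if i = 0 then 1 else 0 :=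
  triBasis_coord h i 0

theorem coord_right {a b o : Plane} (h : AffineIndependent ℝ ![a, b, o]) (i : Fin 3) : (triBasis h).coord i b = if i = 1 then 1 else 0 :=
  triBasis_coord h i 1

theorem coord_top {a b o : Plane} (h : AffineIndependent ℝ ![a, b, o]) (i : Fin 3) : (triBasis h).coord i o = if i = 2 then 1 else 0 :=
  triBasis_coord h i 2

theorem sum_coord {a b o : Plane} (h : AffineIndependent ℝ ![a, b, o]) (x : Plane) : (triBasis h).coord 0 x + (triBasis h).coord 1 x +
    (triBasis h).coord 2 x = 1 := by
  have := (triBasis h).sum_coord_apply_eq_one x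
  rwa [Fin.sum_univ_three] at this

theorem eq_sum_coord {a b o : Plane} (h : AffineIndependent ℝ ![a, b, o]) (x : Plane) : x = (triBasis h).coord 0 x • a + (triBasis h).coord 1 x • b +
    (triBasis h).coord 2 x • o := by
  have := (triBasis h).linear_combination_coord_eq_self x
  rw [Fin.sum_univ_three] at this
  exact this.symm

theorem continuous_coord {a b o : Plane} (h : AffineIndependent ℝ ![a, b, o]) (i : Fin 3) : Continuous ((triBasis h).coord i) :=
  AffineMap.continuous_of_finiteDimensional _

theorem range_triple (a b o : Plane) : range ![a, b, o] = {a, b, o} := by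
  ext x
  simp only [mem_range, Fin.exists_fin_succ]
  simp [eq_comm]

theorem mem_convexHull_triple {a b o : Plane} (h : AffineIndependent ℝ ![a, b, o])
    (x : Plane) :
    x ∈ convexHull ℝ {a, b, o} ↔ ∀ i, 0 ≤ (triBasis h).coord i x := by
  rw [← range_triple, ← coe_triBasis h, (triBasis h).convexHull_eq_nonneg_coord]
  rfl

theorem mem_interior_convexHull_triple {a b o : Plane} (h : AffineIndependent ℝ ![a, b, o])
    (x : Plane) :
    x ∈ interior (convexHull ℝ {a, b, o}) ↔ ∀ i, 0 < (triBasis h).coord i x := by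
  rw [← range_triple, ← coe_triBasis h, (triBasis h).interior_convexHull]
  rfl

theorem coord_of_mem_segment {a b o : Plane} (h : AffineIndependent ℝ ![a, b, o]) {x : Plane} (hx : x ∈ segment ℝ a b) :
    0 ≤ (triBasis h).coord 0 x ∧ 0 ≤ (triBasis h).coord 1 x ∧ (triBasis h).coord 2 x = 0 := by
  rw [segment_eq_image_lineMap] at hx
  obtain ⟨t, ht, rfl⟩ := hx
  simp only [AffineMap.apply_lineMap, coord_left, coord_right, AffineMap.lineMap_apply_ring']
  simp [ht.1, ht.2]

theorem coord_of_mem_openSegment {a b o : Plane} (h : AffineIndependent ℝ ![a, b, o])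
    {x : Plane} (hx : x ∈ openSegment ℝ a b) :
    0 < (triBasis h).coord 0 x ∧ 0 < (triBasis h).coord 1 x ∧ (triBasis h).coord 2 x = 0 := by
  rw [openSegment_eq_image_lineMap] at hx
  obtain ⟨t, ht, rfl⟩ := hx
  simp only [AffineMap.apply_lineMap, coord_left, coord_right, AffineMap.lineMap_apply_ring']
  simp [ht.1, ht.2]

theorem eq_or_mem_openSegment {p q x : Plane} {α β : ℝ} (hα : 0 ≤ α) (hβ : 0 ≤ β)
    (hs : α + β = 1) (hx : x = α • p + β • q) : x = p ∨ x = q ∨ x ∈ openSegment ℝ p q := by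
  rcases hα.eq_or_lt with rfl | hα
  · right; left
    rw [zero_add] at hs
    simp [hx, hs]
  rcases hβ.eq_or_lt with rfl | hβ
  · left
    rw [add_zero] at hs
    simp [hx, hs]
  exact .inr (.inr ⟨α, β, hα, hβ, hs, hx.symm⟩)

theorem mem_openSegment_of_notMem_interior {a b o : Plane} (h : AffineIndependent ℝ ![a, b, o])
    {x : Plane} (hx : x ∈ convexHull ℝ {a, b, o})
    (hx' : x ∉ interior (convexHull ℝ {a, b, o})) :
    x ∈ ({a, b, o} : Set Plane) ∨ x ∈ openSegment ℝ a b ∨ x ∈ openSegment ℝ a o ∨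
      x ∈ openSegment ℝ b o := by
  rw [mem_convexHull_triple h] at hx
  rw [mem_interior_convexHull_triple h] at hx'
  have hs := sum_coord h x
  have he := eq_sum_coord h x
  have h0 := hx 0
  have h1 := hx 1
  have h2 := hx 2
  have hz : (triBasis h).coord 0 x = 0 ∨ (triBasis h).coord 1 x = 0 ∨
      (triBasis h).coord 2 x = 0 := by
    by_contra! hne
    refine hx' fun i => ?_
    fin_cases i
    exacts [h0.lt_of_ne' hne.1, h1.lt_of_ne' hne.2.1, h2.lt_of_ne' hne.2.2]
  generalize (triBasis h).coord 0 x = α at *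
  generalize (triBasis h).coord 1 x = β at *
  generalize (triBasis h).coord 2 x = γ at *
  rcases hz with rfl | rfl | rfl
  · rcases eq_or_mem_openSegment (p := b) (q := o) h1 h2 (by linarith) (x := x)
      (by rw [he]; simp) with h | h | h <;>
      simp [h]
  · rcases eq_or_mem_openSegment (p := a) (q := o) h0 h2 (by linarith) (x := x)
      (by rw [he]; simp) with h | h | h <;>
      simp [h]
  · rcases eq_or_mem_openSegment (p := a) (q := b) h0 h1 (by linarith) (x := x)
      (by rw [he]; simp) with h | h | h <;>
      simp [h]

/-- An affine function that varies by at most 1 along every diameter of length `2 r` has slope at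
most `1 / (2 r)`. Applied to barycentric coordinates, this is how shape regularity enters. -/
theorem abs_sub_le_of_bound_on_ball {f : Plane →ᵃ[ℝ] ℝ} {c : Plane} {r : ℝ} (hr : 0 < r)
    (hf : ∀ z ∈ Metric.closedBall c r, 0 ≤ f z ∧ f z ≤ 1) (y z : Plane) :
    |f y - f z| ≤ dist y z / (2 * r) := by
  rcases eq_or_ne y z with rfl | hne
  · simp
  have hd : 0 < dist y z := dist_pos.2 hne
  have hlin : ∀ u v : Plane, f u - f v = f.linear (u - v) := fun u v => by
    rw [← vsub_eq_sub u v, f.linearMap_vsub, vsub_eq_sub]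
  let u : Plane := (r / dist y z) • (y - z)
  have hu : ‖u‖ = r := by
    rw [norm_smul, ← dist_eq_norm, Real.norm_of_nonneg (by positivity)]
    field_simp
  have h1 := hf (c + u) (by simp [hu])
  have h2 := hf (c - u) (by simp [hu])
  have h3 : f (c + u) - f (c - u) = (2 * r / dist y z) * (f y - f z) := by
    rw [hlin, hlin, show c + u - (c - u) = (2 * r / dist y z) • (y - z) by
      simp only [u, mul_div_assoc]; module]
    simp
  have h4 : |(2 * r / dist y z) * (f y - f z)| ≤ 1 := by
    rw [← h3, abs_le]; constructor <;> linarith [h1.1, h1.2, h2.1, h2.2]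
  rw [abs_mul, abs_of_pos (by positivity)] at h4
  rw [le_div_iff₀ (by positivity)]
  calc _ = (2 * r / dist y z * |f y - f z|) * dist y z := by field_simp
    _ ≤ 1 * dist y z := by gcongr
    _ = _ := one_mul _

theorem coord_bounds_on_ball {a b o : Plane} (h : AffineIndependent ℝ ![a, b, o]) {c : Plane} {r : ℝ}
    (hc : Metric.closedBall c r ⊆ convexHull ℝ {a, b, o}) (i : Fin 3) :
    ∀ z ∈ Metric.closedBall c r, 0 ≤ (triBasis h).coord i z ∧ (triBasis h).coord i z ≤ 1 := by
  intro z hz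
  have h1 := (mem_convexHull_triple h z).1 (hc hz)
  have hs := sum_coord h z
  refine ⟨h1 i, ?_⟩
  have h10 := h1 0
  have h11 := h1 1
  have h12 := h1 2
  fin_cases i <;> simp <;> linarith

/-- The line through the vertex `o` and a point of the opposite edge meets `Γ` close to the edge. -/
theorem exists_mem_line_dist_le {a b o : Plane} (h : AffineIndependent ℝ ![a, b, o])
    {Γ : Set Plane} {ε : ℝ} (hΓ : JoinedNearChord Γ a b ε) {c : Plane}
    {r : ℝ} (hr : 0 < r) (hc : Metric.closedBall c r ⊆ convexHull ℝ {a, b, o}) {t : ℝ}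
    (ht : t ∈ Icc (0 : ℝ) 1) :
    ∃ P ∈ Γ ∩ (line[ℝ, o, AffineMap.lineMap a b t] : Set Plane),
      dist (AffineMap.lineMap a b t) P ≤ ε / (2 * r) * dist o (AffineMap.lineMap a b t) := by
  obtain ⟨S, hS, hSΓ, haS, hbS, hSε⟩ := hΓ
  -- The zero set of `f` is the line through `o` and the edge point of parameter `t`. It separates
  -- `a` from `b`, so a connected part of `Γ` joining them must meet it.
  let f : Plane → ℝ := fun y => (1 - t) * (triBasis h).coord 1 y - t * (triBasis h).coord 0 y
  have hf : Continuous f := by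
    have := continuous_coord h
    fun_prop
  have hfa : f a = -t := by simp [f, coord_left]
  have hfb : f b = 1 - t := by simp [f, coord_right]
  obtain ⟨P, hP, hfP⟩ := hS.intermediate_value haS hbS hf.continuousOn
    (show (0 : ℝ) ∈ Icc (f a) (f b) from ⟨by linarith [ht.1], by linarith [ht.2]⟩)
  set M := AffineMap.lineMap a b t with hM
  set l := (triBasis h).coord 2 P with hl
  have hs := sum_coord h P
  have h0 : (triBasis h).coord 0 P = (1 - l) * (1 - t) := by
    simp only [f] at hfP; linear_combination (1 - t) * hs - hfP
  have h1 : (triBasis h).coord 1 P = (1 - l) * t := by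
    simp only [f] at hfP; linear_combination t * hs + hfP
  have hPM : P = AffineMap.lineMap M o l := by
    rw [eq_sum_coord h P, h0, h1, ← hl, hM, AffineMap.lineMap_apply_module,
      AffineMap.lineMap_apply_module]
    module
  refine ⟨P, ⟨hSΓ hP, ?_⟩, ?_⟩
  · rw [hPM, Set.pair_comm]
    exact AffineMap.lineMap_mem_affineSpan_pair l M o
  · obtain ⟨z, hz, hzε⟩ := hSε P hP
    -- `l` is the third coordinate of `P`. This coordinate vanishes on the chord, which is within
    -- `ε` of `P`, so `|l| ≤ ε / (2 r)`.
    have h2 := abs_sub_le_of_bound_on_ball hr (coord_bounds_on_ball h hc 2) P z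
    rw [(coord_of_mem_segment h hz).2.2, sub_zero, ← hl] at h2
    have h3 : dist M P = |l| * dist o M := by
      conv_lhs => rw [hPM]
      rw [dist_left_lineMap, Real.norm_eq_abs, dist_comm]
    rw [h3]
    have : |l| ≤ ε / (2 * r) := h2.trans (by gcongr)
    gcongr

/-- The perpendicular at `x` separates `a` from `b`, so it meets the arc at some `P`. By Pythagoras
`x` is at least as close to `P` as any other chord point, in particular the one within `ε` of `P`.
-/
theorem exists_perp_dist_le {a b : Plane} {Γ : Set Plane} {ε : ℝ} (hΓ : JoinedNearChord Γ a b ε) {x : Plane}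
    (hx : x ∈ segment ℝ a b) :
    ∃ P ∈ Γ ∩ {y | inner ℝ (y - x) (b - a) = 0}, dist x P ≤ ε := by
  obtain ⟨S, hS, hSΓ, haS, hbS, hSε⟩ := hΓ
  rw [segment_eq_image'] at hx
  obtain ⟨t, ht, rfl⟩ := hx
  set x := a + t • (b - a) with hxdef
  let f : Plane → ℝ := fun y => inner ℝ (y - x) (b - a)
  have hf : Continuous f := by fun_prop
  have hfa : f a = -t * ‖b - a‖ ^ 2 := by
    simp only [f, hxdef, sub_add_cancel_left, inner_neg_left, inner_smul_left,
      real_inner_self_eq_norm_sq]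
    simp
  have hfb : f b = (1 - t) * ‖b - a‖ ^ 2 := by
    simp only [f]
    rw [show b - x = (1 - t) • (b - a) by rw [hxdef]; module, inner_smul_left,
      real_inner_self_eq_norm_sq]
    simp
  obtain ⟨P, hP, hfP⟩ := hS.intermediate_value haS hbS hf.continuousOn
    (show (0 : ℝ) ∈ Icc (f a) (f b) by
      rw [hfa, hfb]
      constructor <;> nlinarith [ht.1, ht.2, sq_nonneg ‖b - a‖])
  refine ⟨P, ⟨hSΓ hP, hfP⟩, ?_⟩
  obtain ⟨z, hz, hzε⟩ := hSε P hP
  rw [segment_eq_image'] at hz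
  obtain ⟨s, hs, rfl⟩ := hz
  refine le_trans ?_ hzε
  have h1 : P - (a + s • (b - a)) = (P - x) + (t - s) • (b - a) := by rw [hxdef]; module
  rw [dist_comm x P, dist_eq_norm, dist_eq_norm, h1]
  refine le_of_sq_le_sq ?_ (norm_nonneg _)
  rw [norm_add_sq_real, inner_smul_right, show inner ℝ (P - x) (b - a) = 0 from hfP]
  nlinarith [sq_nonneg ‖(t - s) • (b - a)‖]

theorem exists_mem_nearestPts {A : Set Plane} (hA : IsClosed A) (x : Plane) (hne : A.Nonempty) :
    ∃ y, y ∈ nearestPts x A := by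
  obtain ⟨y, hy, hxy⟩ := hA.exists_infDist_eq_dist hne x
  exact ⟨y, hy, fun z hz => hxy ▸ Metric.infDist_le_dist_of_mem hz⟩

end Triangles

/-! ### Combinatorics of the mesh and the boundary edges of the polygon. -/

section Mesh

variable {𝒯 : Triangulation} {T : Finset Plane}

theorem isCompact_hull (T : Finset Plane) : IsCompact (hull T) :=
  T.finite_toSet.isCompact_convexHull (𝕜 := ℝ)

theorem isClosed_hull (T : Finset Plane) : IsClosed (hull T) := (isCompact_hull T).isClosed

theorem hull_subset_polygon (hT : T ∈ 𝒯.elems) : hull T ⊆ 𝒯.polygon :=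
  subset_biUnion_of_mem (u := fun T => hull T) hT

theorem isCompact_polygon : IsCompact 𝒯.polygon :=
  𝒯.elems.isCompact_biUnion fun T _ => isCompact_hull T

theorem mem_hull {x : Plane} (hx : x ∈ T) : x ∈ hull T := subset_convexHull ℝ _ hx

theorem exists_triple (hT : T ∈ 𝒯.elems) :
    ∃ a b o : Plane, a ≠ b ∧ a ≠ o ∧ b ≠ o ∧ (T : Set Plane) = {a, b, o} := by
  obtain ⟨a, b, o, h1, h2, h3, h4⟩ := Finset.card_eq_three.1 (𝒯.card_eq T hT)
  exact ⟨a, b, o, h1, h2, h3, by simp [h4]⟩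

theorem affineIndependent_triple (hT : T ∈ 𝒯.elems) {a b o : Plane} (hab : a ≠ b) (hao : a ≠ o)
    (hbo : b ≠ o) (hT' : (T : Set Plane) = {a, b, o}) : AffineIndependent ℝ ![a, b, o] := by
  have hmem : ∀ i, ![a, b, o] i ∈ T := by
    intro i
    rw [← Finset.mem_coe, hT']
    fin_cases i <;> simp
  have hinj : Function.Injective ![a, b, o] := by
    intro i j hij
    fin_cases i <;> fin_cases j <;> simp_all
  let e : Fin 3 ↪ T := ⟨fun i => ⟨![a, b, o] i, hmem i⟩, fun i j hij => hinj (Subtype.ext_iff.1 hij)⟩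
  exact (𝒯.indep T hT).comp_embedding e

/-- Conformity puts `x` in the hull of the common vertices. If vertex `i` were not common,
coordinate `i` would vanish at all of them and could not be positive at `x`. -/
theorem mem_of_mem_hull_inter {T' : Finset Plane} {a b o x : Plane} (hT : T ∈ 𝒯.elems)
    (hTeq : (T : Set Plane) = {a, b, o}) (h : AffineIndependent ℝ ![a, b, o])
    (hT' : T' ∈ 𝒯.elems) (hx : x ∈ hull T) (hx' : x ∈ hull T') (i : Fin 3)
    (hi : 0 < (triBasis h).coord i x) : ![a, b, o] i ∈ T' := by
  by_contra hn
  have hsub : (T : Set Plane) ∩ T' ⊆ {z | (triBasis h).coord i z ≤ 0} := by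
    rintro z ⟨hz, hz'⟩
    rw [hTeq, ← range_triple] at hz
    obtain ⟨j, rfl⟩ := hz
    have hij : i ≠ j := by rintro rfl; exact hn hz'
    simp [triBasis_coord h, hij]
  have hconv : Convex ℝ {z | (triBasis h).coord i z ≤ 0} :=
    (convex_Iic (0 : ℝ)).affine_preimage ((triBasis h).coord i)
  have hmem : x ∈ convexHull ℝ ((T : Set Plane) ∩ T') := by
    rw [← 𝒯.inter_eq T hT T' hT']; exact ⟨hx, hx'⟩
  exact absurd (convexHull_min hsub hconv hmem) (not_le.2 hi)

/-- If two mesh triangles `abo` and `abo'` lie on different sides of `[a, b]`, every point of the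
open edge is interior to the polygon. -/
theorem mem_interior_polygon_of_opposite {T' : Finset Plane} {a b o o' x : Plane}
    (hT : T ∈ 𝒯.elems) (hT' : T' ∈ 𝒯.elems) (hTeq : (T : Set Plane) = {a, b, o})
    (hTeq' : (T' : Set Plane) = {a, b, o'}) (h : AffineIndependent ℝ ![a, b, o])
    (h' : AffineIndependent ℝ ![a, b, o']) (ho' : (triBasis h).coord 2 o' < 0)
    (hx : x ∈ openSegment ℝ a b) : x ∈ interior 𝒯.polygon := by
  let N : Set Plane := {z | 0 < (triBasis h).coord 0 z ∧ 0 < (triBasis h).coord 1 z ∧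
    0 < (triBasis h').coord 0 z ∧ 0 < (triBasis h').coord 1 z}
  have hN : IsOpen N :=
    (isOpen_lt continuous_const (continuous_coord h 0)).inter
      ((isOpen_lt continuous_const (continuous_coord h 1)).inter
        ((isOpen_lt continuous_const (continuous_coord h' 0)).inter
          (isOpen_lt continuous_const (continuous_coord h' 1))))
  refine mem_interior.2 ⟨N, fun z hz => ?_, hN, ?_⟩
  · rcases le_or_gt 0 ((triBasis h).coord 2 z) with h2 | h2
    · refine hull_subset_polygon hT ?_
      unfold hull
      rw [hTeq, mem_convexHull_triple h]
      intro i
      fin_cases i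
      exacts [hz.1.le, hz.2.1.le, h2]
    -- The second coordinate system satisfies `λ₂(z) = λ₂'(z) λ₂(o')`, as `λ₂` vanishes at `a` and
    -- `b`. Since `λ₂(z)` and `λ₂(o')` are negative, `λ₂'(z)` is not.
    · refine hull_subset_polygon hT' ?_
      unfold hull
      rw [hTeq', mem_convexHull_triple h']
      have := affineMap_apply_eq_sum (triBasis h') ((triBasis h).coord 2) z
      rw [Fin.sum_univ_three] at this
      simp [coord_left, coord_right] at this
      intro i
      fin_cases i
      · exact hz.2.2.1.le
      · exact hz.2.2.2.le
      · change 0 ≤ (triBasis h').coord 2 z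
        by_contra! hneg
        nlinarith
  · have h1 := coord_of_mem_openSegment h hx
    have h2 := coord_of_mem_openSegment h' hx
    exact ⟨h1.1, h1.2.1, h2.1, h2.2.1⟩

/-- Being interior to the polygon is decided for the open edge as a whole. If some point of the edge
is interior, a second triangle lies across the edge, and the two triangles together surround every
point of the open edge, including `x`. -/
theorem segment_subset_frontier {a b o x : Plane} (hT : T ∈ 𝒯.elems) (hab : a ≠ b)
    (hao : a ≠ o) (hbo : b ≠ o) (hTeq : (T : Set Plane) = {a, b, o})
    (hx : x ∈ openSegment ℝ a b) (hxf : x ∈ frontier 𝒯.polygon) :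
    segment ℝ a b ⊆ frontier 𝒯.polygon := by
  have h := affineIndependent_triple hT hab hao hbo hTeq
  have hcl : IsClosed 𝒯.polygon := isCompact_polygon.isClosed
  have hseg : segment ℝ a b ⊆ hull T := by
    unfold hull
    rw [hTeq]
    exact segment_subset_convexHull (by simp) (by simp)
  intro y hy
  by_contra hyf
  have hyi : y ∈ interior 𝒯.polygon := by
    by_contra hyi
    exact hyf ⟨subset_closure (hull_subset_polygon hT (hseg hy)), hyi⟩
  refine hxf.2 ?_
  -- a point of the open edge that is interior to the polygon
  obtain ⟨y', hy', hyi'⟩ : ∃ y' ∈ openSegment ℝ a b, y' ∈ interior 𝒯.polygon := by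
    have hc : Continuous fun t : ℝ => AffineMap.lineMap y x t := AffineMap.lineMap_continuous
    have hev : ∀ᶠ t in nhdsWithin (0 : ℝ) (Ioi 0), AffineMap.lineMap y x t ∈ interior 𝒯.polygon :=
      ((hc.tendsto' 0 y (by simp)).mono_left nhdsWithin_le_nhds).eventually
        (isOpen_interior.mem_nhds hyi)
    have hev2 : ∀ᶠ t in nhdsWithin (0 : ℝ) (Ioi 0), t ∈ Ioo (0 : ℝ) 1 := Ioo_mem_nhdsGT one_pos
    obtain ⟨t, ht, ht'⟩ := (hev.and hev2).exists
    refine ⟨_, ?_, ht⟩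
    rw [segment_eq_image_lineMap] at hy
    rw [openSegment_eq_image_lineMap] at hx ⊢
    obtain ⟨u, hu, rfl⟩ := hy
    obtain ⟨v, hv, rfl⟩ := hx
    refine ⟨(1 - t) * u + t * v, ⟨?_, ?_⟩, ?_⟩
    · nlinarith [ht'.1, ht'.2, hu.1, hv.1]
    · nlinarith [ht'.1, ht'.2, hu.2, hv.2]
    · simp only [AffineMap.lineMap_apply_module]
      module
  have hyh : y' ∈ hull T := hseg (openSegment_subset_segment _ _ _ hy')
  have hyc := coord_of_mem_openSegment h hy'
  -- a mesh triangle that contains this point and enters the other side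
  obtain ⟨T', hT', hyT', g, hg, hg2⟩ : ∃ T' ∈ 𝒯.elems, y' ∈ hull T' ∧
      ∃ g ∈ hull T', (triBasis h).coord 2 g < 0 := by
    classical
    -- By finiteness, `V` is a neighbourhood of `y'` that avoids all triangles not containing `y'`.
    -- A short step from `y'` away from `o` therefore lands in a triangle that contains `y'`.
    let V : Set Plane := ⋂ T' ∈ 𝒯.elems.filter (fun T' => y' ∉ hull T'), (hull T')ᶜ
    have hV : IsOpen V := isOpen_biInter_finset fun T' _ => (isClosed_hull T').isOpen_compl
    have hyV : y' ∈ V := by simp [V]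
    have hc : Continuous fun t : ℝ => AffineMap.lineMap y' o t := AffineMap.lineMap_continuous
    have hev : ∀ᶠ t in nhdsWithin (0 : ℝ) (Iio 0),
        AffineMap.lineMap y' o t ∈ interior 𝒯.polygon ∩ V :=
      ((hc.tendsto' 0 y' (by simp)).mono_left nhdsWithin_le_nhds).eventually
        ((isOpen_interior.inter hV).mem_nhds ⟨hyi', hyV⟩)
    obtain ⟨t, ht, ht0⟩ := (hev.and self_mem_nhdsWithin).exists
    obtain ⟨T', hT', htT'⟩ := mem_iUnion₂.1 (interior_subset ht.1)
    refine ⟨T', hT', ?_, _, htT', ?_⟩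
    · by_contra hn
      exact mem_iInter₂.1 ht.2 T' (Finset.mem_filter.2 ⟨hT', hn⟩) htT'
    · rw [AffineMap.apply_lineMap, hyc.2.2, coord_top, AffineMap.lineMap_apply_ring']
      simpa using ht0
  have haT' : a ∈ T' := mem_of_mem_hull_inter hT hTeq h hT' hyh hyT' 0 hyc.1
  have hbT' : b ∈ T' := mem_of_mem_hull_inter hT hTeq h hT' hyh hyT' 1 hyc.2.1
  obtain ⟨o', ho'⟩ : ∃ o', (T'.erase a).erase b = {o'} := by
    rw [← Finset.card_eq_one, Finset.card_erase_of_mem (by simp [hbT', hab.symm]),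
      Finset.card_erase_of_mem haT', 𝒯.card_eq T' hT']
  have ho'mem : o' ∈ (T'.erase a).erase b := by simp [ho']
  simp only [Finset.mem_erase] at ho'mem
  have hTeq' : (T' : Set Plane) = {a, b, o'} := by
    rw [← Finset.insert_erase haT',
      ← Finset.insert_erase (show b ∈ T'.erase a by simp [hbT', hab.symm]), ho']
    simp
  refine mem_interior_polygon_of_opposite hT hT' hTeq hTeq' h
    (affineIndependent_triple hT' hab ho'mem.2.1.symm ho'mem.1.symm hTeq') ?_ hx
  -- Otherwise the three vertices of `T'`, hence all of `T'`, would be on the side of `o`, contrary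
  -- to the choice of `g`.
  by_contra! hnn
  have hsub : (T' : Set Plane) ⊆ {z | 0 ≤ (triBasis h).coord 2 z} := by
    rw [hTeq']
    rintro z (rfl | rfl | rfl)
    · simp [coord_left]
    · simp [coord_right]
    · exact hnn
  have hconv : Convex ℝ {z | 0 ≤ (triBasis h).coord 2 z} :=
    (convex_Ici (0 : ℝ)).affine_preimage ((triBasis h).coord 2)
  exact absurd (convexHull_min hsub hconv hg) (not_le.2 hg2)

/-- The points of a mesh triangle on the boundary of the polygon are vertices or lie on an edge
that is contained in this boundary. -/
theorem mem_or_mem_boundary_segment {x : Plane} (hT : T ∈ 𝒯.elems) (hx : x ∈ hull T)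
    (hxf : x ∈ frontier 𝒯.polygon) :
    x ∈ T ∨ ∃ a b o, 𝒯.BoundaryTriple T a b o ∧ x ∈ segment ℝ a b := by
  obtain ⟨a, b, o, hab, hao, hbo, hTeq⟩ := exists_triple hT
  have h := affineIndependent_triple hT hab hao hbo hTeq
  have hxi : x ∉ interior (hull T) := fun hi => hxf.2 (interior_mono (hull_subset_polygon hT) hi)
  unfold hull at hx hxi
  rw [hTeq] at hx hxi
  have key : ∀ a b o : Plane, a ≠ b → a ≠ o → b ≠ o → (T : Set Plane) = {a, b, o} →
      x ∈ openSegment ℝ a b → ∃ a b o, 𝒯.BoundaryTriple T a b o ∧ x ∈ segment ℝ a b :=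
    fun a b o hab hao hbo hTeq hx => ⟨a, b, o, ⟨hT, hab, hao, hbo, hTeq,
      segment_subset_frontier hT hab hao hbo hTeq hx hxf⟩, openSegment_subset_segment _ _ _ hx⟩
  rcases mem_openSegment_of_notMem_interior h hx hxi with h1 | h1 | h1 | h1
  · left; rwa [← Finset.mem_coe, hTeq]
  · exact .inr (key a b o hab hao hbo hTeq h1)
  · exact .inr (key a o b hao hab hbo.symm (by rw [hTeq, Set.pair_comm b o]) h1)
  · exact .inr (key b o a hbo hab.symm hao.symm (by
      rw [hTeq, Set.insert_comm a b, Set.pair_comm a o]) h1)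

end Mesh

/-! ### Polynomial extension of edge values into a triangle. -/

section EdgeCorrection

/-- An affine function as a polynomial. -/
def affPoly (f : Plane →ᵃ[ℝ] ℝ) : MvPolynomial (Fin 2) ℝ :=
  C (f 0) + ∑ i, f.linear (EuclideanSpace.single i 1) • X i

theorem totalDegree_affPoly_le (f : Plane →ᵃ[ℝ] ℝ) : (affPoly f).totalDegree ≤ 1 := by
  refine (totalDegree_add _ _).trans (max_le (by simp) ?_)
  exact totalDegree_finsetSum_le fun i _ => (totalDegree_smul_le _ _).trans (by simp)

theorem polyVal_affPoly (f : Plane →ᵃ[ℝ] ℝ) (x : Plane) : polyVal (affPoly f) x = f x := by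
  have h1 : f x = f.linear x + f 0 := congrFun f.decomp x
  have h2 : x = ∑ i, x i • EuclideanSpace.single i (1 : ℝ) := by
    ext j; fin_cases j <;> simp
  rw [h1]
  conv_rhs => rw [h2]
  simp [affPoly, polyVal]
  ring

theorem polyVal_eq_aeval (p : MvPolynomial (Fin 2) ℝ) (x : Plane) :
    polyVal p x = MvPolynomial.aeval (fun i => x i) p := by
  unfold polyVal
  rw [← MvPolynomial.coe_aeval_eq_eval]
  rfl

theorem polyVal_polynomial_aeval (g : MvPolynomial (Fin 2) ℝ) (s : Polynomial ℝ) (x : Plane) :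
    polyVal (Polynomial.aeval g s) x = s.eval (polyVal g x) := by
  rw [polyVal_eq_aeval, polyVal_eq_aeval, ← Polynomial.aeval_algHom_apply, Polynomial.aeval_def,
    Polynomial.eval₂_eq_eval_map]
  simp

theorem totalDegree_polynomial_aeval_le {g : MvPolynomial (Fin 2) ℝ} (hg : g.totalDegree ≤ 1)
    (s : Polynomial ℝ) : (Polynomial.aeval g s).totalDegree ≤ s.natDegree := by
  rw [Polynomial.aeval_eq_sum_range]
  refine totalDegree_finsetSum_le fun i hi => (totalDegree_smul_le _ _).trans ?_
  refine (totalDegree_pow _ _).trans ?_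
  have := Finset.mem_range.1 hi
  calc _ ≤ i * 1 := Nat.mul_le_mul_left _ hg
    _ ≤ _ := by omega

/-- The restriction of a polynomial to a line. -/
def restrictLine (a b : Plane) (p : MvPolynomial (Fin 2) ℝ) : Polynomial ℝ :=
  MvPolynomial.aeval (fun i => Polynomial.C (a i) + Polynomial.C (b i - a i) * Polynomial.X) p

theorem eval_restrictLine (a b : Plane) (p : MvPolynomial (Fin 2) ℝ) (t : ℝ) :
    (restrictLine a b p).eval t = polyVal p (AffineMap.lineMap a b t) := by
  rw [polyVal_eq_aeval, ← Polynomial.coe_evalRingHom, restrictLine]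
  have h := MvPolynomial.comp_aeval_apply
    (f := fun i => Polynomial.C (a i) + Polynomial.C (b i - a i) * Polynomial.X)
    (Polynomial.aeval t) p
  simp only [Polynomial.coe_aeval_eq_eval] at h
  rw [Polynomial.coe_evalRingHom, h]
  congr 2
  ext i
  simp [AffineMap.lineMap_apply]
  ring

theorem natDegree_restrictLine_le (a b : Plane) (p : MvPolynomial (Fin 2) ℝ) :
    (restrictLine a b p).natDegree ≤ p.totalDegree := by
  unfold restrictLine
  conv_lhs => rw [p.as_sum, map_sum]
  refine Polynomial.natDegree_sum_le_of_forall_le _ _ fun s hs => ?_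
  rw [MvPolynomial.aeval_monomial]
  refine le_trans ?_ (le_totalDegree hs)
  refine (Polynomial.natDegree_C_mul_le _ _).trans ?_
  refine (Polynomial.natDegree_prod_le _ _).trans (Finset.sum_le_sum fun i _ => ?_)
  refine Polynomial.natDegree_pow_le.trans ?_
  have : (Polynomial.C (a i) + Polynomial.C (b i - a i) * Polynomial.X).natDegree ≤ 1 := by
    compute_degree
  simpa using Nat.mul_le_mul_left (s i) this

/-- The bound is written `s.natDegree + 2 ≤ k` so that it also covers `r = 0`, thanks to `2 ≤ k`. -/
theorem exists_eq_X_mul_one_sub_X_mul {r : Polynomial ℝ} {k : ℕ} (hk : 2 ≤ k)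
    (hr : r.natDegree ≤ k) (h0 : r.eval 0 = 0) (h1 : r.eval 1 = 0) :
    ∃ s : Polynomial ℝ, s.natDegree + 2 ≤ k ∧ r = Polynomial.X * (1 - Polynomial.X) * s := by
  obtain ⟨r₁, rfl⟩ := Polynomial.dvd_iff_isRoot.2 (show r.IsRoot 0 from h0)
  have h1' : r₁.eval 1 = 0 := by simpa using h1
  obtain ⟨r₂, rfl⟩ := Polynomial.dvd_iff_isRoot.2 (show r₁.IsRoot 1 from h1')
  refine ⟨-r₂, ?_, by simp; ring⟩
  rcases eq_or_ne r₂ 0 with rfl | hne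
  · simpa using hk
  · rw [Polynomial.natDegree_mul (Polynomial.X_sub_C_ne_zero _)
      (mul_ne_zero (Polynomial.X_sub_C_ne_zero _) hne),
      Polynomial.natDegree_mul (Polynomial.X_sub_C_ne_zero _) hne, Polynomial.natDegree_X_sub_C,
      Polynomial.natDegree_X_sub_C] at hr
    rw [Polynomial.natDegree_neg]
    omega

/-- Lagrange interpolation of the polynomials on `[0, 1]` that vanish at both end points. -/
theorem exists_bubble_basis {k : ℕ} (hk : 2 ≤ k) :
    ∃ s : ℕ → Polynomial ℝ, (∀ j ∈ Finset.Icc 1 (k - 1), (s j).natDegree + 2 ≤ k) ∧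
      ∀ r : Polynomial ℝ, r.natDegree ≤ k → r.eval 0 = 0 → r.eval 1 = 0 →
        r = Polynomial.X * (1 - Polynomial.X) *
          ∑ j ∈ Finset.Icc 1 (k - 1), Polynomial.C (r.eval ((j : ℝ) / k)) * s j := by
  have hk0 : (k : ℝ) ≠ 0 := by positivity
  let v : ℕ → ℝ := fun j => (j : ℝ) / k
  have hv : Set.InjOn v (Finset.range (k + 1)) := by
    intro i _ j _ hij
    simpa [v, div_left_inj' hk0] using hij
  have hv0 : v 0 = 0 := by simp [v]
  have hvk : v k = 1 := by simp [v, hk0]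
  have hex : ∀ j ∈ Finset.Icc 1 (k - 1), ∃ s : Polynomial ℝ, s.natDegree + 2 ≤ k ∧
      Lagrange.basis (Finset.range (k + 1)) v j = Polynomial.X * (1 - Polynomial.X) * s := by
    intro j hj
    have hj' := Finset.mem_Icc.1 hj
    refine exists_eq_X_mul_one_sub_X_mul hk ?_ ?_ ?_
    · have := Lagrange.degree_basis hv (i := j) (Finset.mem_range.2 (by omega))
      exact Polynomial.natDegree_le_of_degree_le (by rw [this]; simp)
    · have := Lagrange.eval_basis_of_ne (s := Finset.range (k + 1)) (v := v) (i := j) (j := 0)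
        (by omega) (Finset.mem_range.2 (by omega))
      rwa [hv0] at this
    · have := Lagrange.eval_basis_of_ne (s := Finset.range (k + 1)) (v := v) (i := j) (j := k)
        (by omega) (Finset.mem_range.2 (by omega))
      rwa [hvk] at this
  choose! s hs hs' using hex
  refine ⟨s, hs, fun r hr h0 h1 => ?_⟩
  have hdeg : r.degree < (Finset.range (k + 1)).card := by
    rw [Finset.card_range]
    exact Polynomial.degree_le_natDegree.trans_lt (by exact_mod_cast Nat.lt_succ_of_le hr)
  have hint := Lagrange.eq_interpolate hv hdeg
  -- The nodes are `j / k` for `0 ≤ j ≤ k`. The terms `j = 0` and `j = k` are split off because `r`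
  -- vanishes there.
  rw [Lagrange.interpolate_apply, Finset.sum_range_succ, ← Nat.Ico_zero_eq_range,
    Finset.sum_eq_sum_Ico_succ_bot (by omega)] at hint
  simp only [hv0, hvk, h0, h1, Polynomial.C_0, zero_mul, zero_add, add_zero] at hint
  conv_lhs => rw [hint]
  rw [Finset.mul_sum]
  have hI : Finset.Ico 1 k = Finset.Icc 1 (k - 1) := by
    ext j; simp; omega
  rw [hI]
  refine Finset.sum_congr rfl fun j hj => ?_
  rw [hs' j hj]
  ring

/-- On the edge, `p` equals `t (1 - t) S(t)`. Replacing `t` by `λ₁` and `1 - t` by `λ₀` gives `q =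
λ₁ λ₀ S(λ₁)`, where `λ₀` vanishes on `[b, o]` and `λ₁` on `[a, o]`. The bound on `S` over `[0, 1]`
does not involve the triangle, so the constant is uniform without any shape regularity. -/
theorem exists_edge_correction {k : ℕ} (hk : 2 ≤ k) :
    ∃ C : ℝ, 0 < C ∧ ∀ a b o : Plane, AffineIndependent ℝ ![a, b, o] →
      ∀ p : MvPolynomial (Fin 2) ℝ, p.totalDegree ≤ k → polyVal p a = 0 → polyVal p b = 0 →
        ∃ q : MvPolynomial (Fin 2) ℝ, q.totalDegree ≤ k ∧
          (∀ x ∈ segment ℝ a b, polyVal q x = polyVal p x) ∧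
          (∀ x ∈ segment ℝ a o, polyVal q x = 0) ∧ (∀ x ∈ segment ℝ b o, polyVal q x = 0) ∧
          ∀ B : ℝ, (∀ j : ℕ, 1 ≤ j → j ≤ k - 1 →
              |polyVal p (AffineMap.lineMap a b ((j : ℝ) / k))| ≤ B) →
            ∀ x ∈ convexHull ℝ {a, b, o}, |polyVal q x| ≤ C * B := by
  obtain ⟨s, hs, hint⟩ := exists_bubble_basis hk
  have hbd : ∀ j, ∃ C : ℝ, ∀ t ∈ Icc (0 : ℝ) 1, |(s j).eval t| ≤ C := fun j => by
    obtain ⟨C, hC⟩ := isCompact_Icc.exists_bound_of_continuousOn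
      (s := Icc (0 : ℝ) 1) (f := fun t => (s j).eval t) (s j).continuous.continuousOn
    exact ⟨C, hC⟩
  choose C hC using hbd
  have hC0 : ∀ j, 0 ≤ C j := fun j => (abs_nonneg _).trans (hC j 0 (by simp))
  refine ⟨∑ j ∈ Finset.Icc 1 (k - 1), C j + 1,
    add_pos_of_nonneg_of_pos (Finset.sum_nonneg fun j _ => hC0 j) one_pos,
    fun a b o h p hp hpa hpb => ?_⟩
  set r := restrictLine a b p with hr
  have hr0 : r.eval 0 = 0 := by rw [hr, eval_restrictLine]; simpa using hpa
  have hr1 : r.eval 1 = 0 := by rw [hr, eval_restrictLine]; simpa using hpb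
  have hreq := hint r ((natDegree_restrictLine_le a b p).trans hp) hr0 hr1
  set S := ∑ j ∈ Finset.Icc 1 (k - 1), Polynomial.C (r.eval ((j : ℝ) / k)) * s j with hS
  have hSdeg : S.natDegree ≤ k - 2 := Polynomial.natDegree_sum_le_of_forall_le _ _ fun j hj =>
    (Polynomial.natDegree_C_mul_le _ _).trans (by have := hs j hj; omega)
  let lam : Fin 3 → MvPolynomial (Fin 2) ℝ := fun i => affPoly ((triBasis h).coord i)
  have hlam : ∀ i, (lam i).totalDegree ≤ 1 := fun i => totalDegree_affPoly_le _
  let q := lam 1 * lam 0 * Polynomial.aeval (lam 1) S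
  have hq : ∀ x, polyVal q x = (triBasis h).coord 1 x * (triBasis h).coord 0 x *
      S.eval ((triBasis h).coord 1 x) := fun x => by
    simp only [q, polyVal_mul, polyVal_polynomial_aeval, lam, polyVal_affPoly]
  refine ⟨q, ?_, fun x hx => ?_, fun x hx => ?_, fun x hx => ?_, fun B hB x hx => ?_⟩
  · refine (totalDegree_mul _ _).trans ?_
    have h1 := totalDegree_mul (lam 1) (lam 0)
    have h2 := totalDegree_polynomial_aeval_le (hlam 1) S
    have := hlam 0
    have := hlam 1
    omega
  · rw [segment_eq_image_lineMap] at hx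
    obtain ⟨t, ht, rfl⟩ := hx
    rw [← eval_restrictLine a b p, ← hr, hreq, hq]
    have e0 : (triBasis h).coord 0 (AffineMap.lineMap a b t) = 1 - t := by
      simp [AffineMap.apply_lineMap, coord_left, coord_right, AffineMap.lineMap_apply_ring']
      ring
    have e1 : (triBasis h).coord 1 (AffineMap.lineMap a b t) = t := by
      simp [AffineMap.apply_lineMap, coord_left, coord_right, AffineMap.lineMap_apply_ring']
    simp only [e0, e1, Polynomial.eval_mul, Polynomial.eval_X, Polynomial.eval_sub,
      Polynomial.eval_one]
  · rw [segment_eq_image_lineMap] at hx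
    obtain ⟨t, ht, rfl⟩ := hx
    rw [hq]
    simp [AffineMap.apply_lineMap, coord_left, coord_top]
  · rw [segment_eq_image_lineMap] at hx
    obtain ⟨t, ht, rfl⟩ := hx
    rw [hq]
    simp [AffineMap.apply_lineMap, coord_right, coord_top]
  · have hx' := (mem_convexHull_triple h x).1 hx
    have hsum := sum_coord h x
    have h0 := hx' 0
    have h1 := hx' 1
    have h2 := hx' 2
    rw [hq]
    set t := (triBasis h).coord 1 x
    set u := (triBasis h).coord 0 x
    have hB0 : 0 ≤ B := (abs_nonneg _).trans (hB 1 le_rfl (by omega))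
    have hSB : |S.eval t| ≤ ∑ j ∈ Finset.Icc 1 (k - 1), C j * B := by
      rw [hS, Polynomial.eval_finsetSum]
      refine (Finset.abs_sum_le_sum_abs _ _).trans (Finset.sum_le_sum fun j hj => ?_)
      have hj' := Finset.mem_Icc.1 hj
      rw [Polynomial.eval_mul, Polynomial.eval_C, abs_mul, mul_comm]
      have h3 := hB j hj'.1 hj'.2
      rw [← eval_restrictLine, ← hr] at h3
      exact mul_le_mul (hC j t ⟨h1, by linarith⟩) h3 (abs_nonneg _) (hC0 j)
    rw [abs_mul, abs_mul, abs_of_nonneg h0, abs_of_nonneg h1]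
    rw [← Finset.sum_mul] at hSB
    have h4 : t * u ≤ 1 := by nlinarith
    calc t * u * |S.eval t| ≤ 1 * |S.eval t| := by gcongr
      _ ≤ _ := by rw [one_mul]; refine hSB.trans ?_; gcongr; linarith

end EdgeCorrection

/-! ### Estimates for one element. -/

section LocalEstimates

theorem continuous_norm_polyGrad_sq (p : MvPolynomial (Fin 2) ℝ) :
    Continuous fun x => ‖polyGrad p x‖ ^ 2 := (continuous_polyGrad p).norm.pow 2

theorem integrableOn_norm_polyGrad_sq (p : MvPolynomial (Fin 2) ℝ) {D : Set Plane}
    (hD : IsCompact D) : IntegrableOn (fun x => ‖polyGrad p x‖ ^ 2) D :=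
  (continuous_norm_polyGrad_sq p).continuousOn.integrableOn_compact hD

theorem setIntegral_norm_polyGrad_sq_mono (p : MvPolynomial (Fin 2) ℝ) {D E : Set Plane}
    (hE : IsCompact E) (h : D ⊆ E) :
    ∫ x in D, ‖polyGrad p x‖ ^ 2 ≤ ∫ x in E, ‖polyGrad p x‖ ^ 2 :=
  setIntegral_mono_set (integrableOn_norm_polyGrad_sq p hE)
    (Filter.Eventually.of_forall fun _ => by positivity) (Filter.Eventually.of_forall h)

theorem setIntegral_le_of_bound {f : Plane → ℝ} (hf : Continuous f) {D : Set Plane}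
    (hD : IsCompact D) {c : Plane} {ρ B : ℝ} (hρ : 0 ≤ ρ) (hDc : D ⊆ Metric.closedBall c ρ)
    (hB : 0 ≤ B) (h : ∀ x ∈ D, f x ≤ B) : ∫ x in D, f x ≤ Real.pi * ρ ^ 2 * B := by
  have hfin : volume D ≠ ⊤ := hD.measure_lt_top.ne
  have hvol : volume.real D ≤ Real.pi * ρ ^ 2 := by
    refine (measureReal_mono hDc measure_closedBall_lt_top.ne).trans (le_of_eq ?_)
    rw [measureReal_def, EuclideanSpace.volume_closedBall_fin_two]
    simp [ENNReal.toReal_ofReal hρ, mul_comm, Real.pi_nonneg]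
  calc _ ≤ ∫ x in D, B := setIntegral_mono_on (hf.continuousOn.integrableOn_compact hD)
        (integrableOn_const hfin) hD.measurableSet h
    _ = volume.real D * B := by simp
    _ ≤ _ := by gcongr

theorem exists_setIntegral_closedBall_le (k : ℕ) {R : ℝ} (hR : 0 ≤ R) :
    ∃ K : ℝ, 0 < K ∧ ∀ p : MvPolynomial (Fin 2) ℝ, p.totalDegree ≤ k → ∀ (c : Plane) (r : ℝ),
      0 < r → ∀ D : Set Plane, IsCompact D → Metric.closedBall c r ⊆ D →
        ∫ x in Metric.closedBall c (R * r), ‖polyGrad p x‖ ^ 2 ≤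
          K * ∫ x in D, ‖polyGrad p x‖ ^ 2 := by
  obtain ⟨C, hC, h⟩ := exists_norm_polyGrad_sq_le k R
  -- Area of the large disc times the pointwise bound; the added 1 keeps the constant positive when
  -- `R = 0`.
  refine ⟨Real.pi * R ^ 2 * C + 1, by positivity, fun p hp c r hr D hD hcD => ?_⟩
  set A := ∫ x in D, ‖polyGrad p x‖ ^ 2
  have hA : 0 ≤ A := integral_nonneg fun _ => by positivity
  have h1 : ∀ x ∈ Metric.closedBall c (R * r), ‖polyGrad p x‖ ^ 2 ≤ C * A / r ^ 2 := by
    intro x hx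
    rw [le_div_iff₀ (by positivity)]
    refine (h p hp c r hr x hx).trans ?_
    gcongr
    exact setIntegral_norm_polyGrad_sq_mono p hD hcD
  refine (setIntegral_le_of_bound (continuous_norm_polyGrad_sq p) (isCompact_closedBall _ _)
    (by positivity) Subset.rfl (by positivity) h1).trans ?_
  calc _ = Real.pi * R ^ 2 * C * A := by field_simp
    _ ≤ _ := by nlinarith

theorem abs_polyVal_sub_le {p : MvPolynomial (Fin 2) ℝ} {D : Set Plane} (hD : Convex ℝ D) {G : ℝ}
    (hG : ∀ x ∈ D, ‖polyGrad p x‖ ≤ G) {x y : Plane} (hx : x ∈ D) (hy : y ∈ D) :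
    |polyVal p x - polyVal p y| ≤ G * dist x y := by
  have h := hD.norm_image_sub_le_of_norm_hasFDerivWithin_le (f := polyVal p) (C := G)
    (f' := fun x => InnerProductSpace.toDual ℝ Plane (polyGrad p x))
    (fun z _ => (hasGradientAt_polyVal p z).hasFDerivAt.hasFDerivWithinAt)
    (fun z hz => by rw [LinearIsometryEquiv.norm_map]; exact hG z hz) hy hx
  rwa [← dist_eq_norm x y, Real.norm_eq_abs] at h

theorem exists_small_edge_correction {k : ℕ} (hk : 2 ≤ k) {s C : ℝ} (hs : 0 < s) (hC : 0 < C) :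
    ∃ K : ℝ, 0 < K ∧ ∀ a b o : Plane, AffineIndependent ℝ ![a, b, o] →
      ∀ (c : Plane) (r H : ℝ), 0 < r → 0 ≤ H → H ≤ 2 * s * r → C * H ≤ 1 →
      Metric.closedBall c r ⊆ convexHull ℝ {a, b, o} →
      convexHull ℝ {a, b, o} ⊆ Metric.closedBall c H →
      ∀ p : MvPolynomial (Fin 2) ℝ, p.totalDegree ≤ k → polyVal p a = 0 → polyVal p b = 0 →
        (∀ j : ℕ, 1 ≤ j → j ≤ k - 1 → ∃ P, polyVal p P = 0 ∧
          dist (AffineMap.lineMap a b ((j : ℝ) / k)) P ≤ C * H ^ 2) →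
        ∃ q : MvPolynomial (Fin 2) ℝ, q.totalDegree ≤ k ∧
          (∀ x ∈ segment ℝ a b, polyVal q x = polyVal p x) ∧
          (∀ x ∈ segment ℝ a o, polyVal q x = 0) ∧ (∀ x ∈ segment ℝ b o, polyVal q x = 0) ∧
          ∫ x in convexHull ℝ {a, b, o}, ‖polyGrad q x‖ ^ 2 ≤
            K * H ^ 2 * ∫ x in convexHull ℝ {a, b, o}, ‖polyGrad p x‖ ^ 2 := by
  obtain ⟨C₁, hC₁, h₁⟩ := exists_norm_polyGrad_sq_le k (4 * s)
  obtain ⟨C₂, hC₂, h₂⟩ := exists_edge_correction hk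
  obtain ⟨C₃, hC₃, h₃⟩ := exists_norm_polyGrad_sq_le_of_bound k (4 * s)
  -- The product of the area bound `π H²`, the inverse inequality `C₃ (C₂ B)² / r²` and `B² = C₁ A
  -- (C H²)² / r²`, with `(H / r)⁴ ≤ (2 s)⁴`; one factor `H²` is left over.
  refine ⟨Real.pi * C₃ * C₂ ^ 2 * C ^ 2 * C₁ * (2 * s) ^ 4, by positivity, ?_⟩
  intro a b o h c r H hr hH hHr hCH hc hcH p hp hpa hpb hnodes
  obtain ⟨q, hq, hq1, hq2, hq3, hqB⟩ := h₂ a b o h p hp hpa hpb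
  refine ⟨q, hq, hq1, hq2, hq3, ?_⟩
  have hcpt : IsCompact (convexHull ℝ ({a, b, o} : Set Plane)) :=
    (Set.toFinite _).isCompact_convexHull (𝕜 := ℝ)
  set A := ∫ x in convexHull ℝ {a, b, o}, ‖polyGrad p x‖ ^ 2
  have hA : 0 ≤ A := integral_nonneg fun _ => by positivity
  have hgrad : ∀ x ∈ Metric.closedBall c (4 * s * r), ‖polyGrad p x‖ ≤ Real.sqrt (C₁ * A) / r := by
    intro x hx
    rw [le_div_iff₀ hr]
    refine Real.le_sqrt_of_sq_le ?_
    rw [mul_pow]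
    refine (h₁ p hp c r hr x hx).trans ?_
    gcongr
    exact setIntegral_norm_polyGrad_sq_mono p hcpt hc
  set B := Real.sqrt (C₁ * A) / r * (C * H ^ 2)
  have hB : ∀ j : ℕ, 1 ≤ j → j ≤ k - 1 →
      |polyVal p (AffineMap.lineMap a b ((j : ℝ) / k))| ≤ B := by
    intro j hj hj'
    obtain ⟨P, hP, hPM⟩ := hnodes j hj hj'
    have hkpos : (0 : ℝ) < k := by positivity
    have hM : AffineMap.lineMap a b ((j : ℝ) / k) ∈ Metric.closedBall c H := by
      refine hcH (segment_subset_convexHull (x := a) (y := b) (by simp) (by simp) ?_)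
      rw [segment_eq_image_lineMap]
      refine ⟨_, ⟨by positivity, ?_⟩, rfl⟩
      rw [div_le_one hkpos]
      exact_mod_cast (by omega : j ≤ k)
    -- `P` is within `C H² ≤ H` of `M`, hence within `2 H ≤ 4 s r` of `c`: this explains the
    -- enlargement factor `4 s`.
    have hP' : P ∈ Metric.closedBall c (4 * s * r) := by
      rw [Metric.mem_closedBall] at hM ⊢
      have := dist_triangle_left P c (AffineMap.lineMap a b ((j : ℝ) / k))
      nlinarith
    have hM' := Metric.closedBall_subset_closedBall (by nlinarith : H ≤ 4 * s * r) hM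
    have := abs_polyVal_sub_le (convex_closedBall c _) hgrad hM' hP'
    rw [hP, sub_zero] at this
    exact this.trans (mul_le_mul_of_nonneg_left hPM (by positivity))
  have hB2 : B ^ 2 = C₁ * A / r ^ 2 * (C * H ^ 2) ^ 2 := by
    simp only [B]
    rw [mul_pow, div_pow, Real.sq_sqrt (by positivity)]
  have hqgrad : ∀ x ∈ convexHull ℝ {a, b, o}, ‖polyGrad q x‖ ^ 2 ≤ C₃ * (C₂ * B) ^ 2 / r ^ 2 := by
    intro x hx
    rw [le_div_iff₀ (by positivity)]
    refine h₃ q hq c r hr (C₂ * B) (fun y hy => hqB B hB y (hc hy)) x ?_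
    exact Metric.closedBall_subset_closedBall (by nlinarith) (hcH hx)
  refine (setIntegral_le_of_bound (continuous_norm_polyGrad_sq q) hcpt hH hcH (by positivity)
    hqgrad).trans ?_
  rw [mul_pow, hB2]
  have hHr4 : H ^ 4 ≤ (2 * s * r) ^ 4 := by gcongr
  calc _ = Real.pi * C₃ * C₂ ^ 2 * C ^ 2 * C₁ * A * H ^ 2 * (H ^ 4 / r ^ 4) := by field_simp
    _ ≤ Real.pi * C₃ * C₂ ^ 2 * C ^ 2 * C₁ * A * H ^ 2 * (2 * s) ^ 4 := by
        gcongr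
        rw [div_le_iff₀ (by positivity), ← mul_pow]
        exact hHr4
    _ = _ := by ring

end LocalEstimates

/-! ### Construction of the correction on every element of a fine mesh. -/

section Elements

variable {𝒯 : Triangulation} {T : Finset Plane} {Ω : Set Plane}

theorem Triangulation.BoundaryTriple.affineIndependent {a b o : Plane}
    (h : 𝒯.BoundaryTriple T a b o) : AffineIndependent ℝ ![a, b, o] :=
  affineIndependent_triple h.1 h.2.1 h.2.2.1 h.2.2.2.1 h.2.2.2.2.1

theorem Triangulation.BoundaryTriple.hull_eq {a b o : Plane} (h : 𝒯.BoundaryTriple T a b o) :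
    hull T = convexHull ℝ {a, b, o} := by
  unfold hull; rw [h.2.2.2.2.1]

theorem Triangulation.BoundaryTriple.mem {a b o : Plane} (h : 𝒯.BoundaryTriple T a b o) :
    a ∈ T ∧ b ∈ T ∧ o ∈ T := by
  simp only [← Finset.mem_coe, h.2.2.2.2.1]; simp

theorem Triangulation.BoundaryTriple.segment_subset_hull {a b o : Plane}
    (h : 𝒯.BoundaryTriple T a b o) : segment ℝ a b ⊆ hull T := by
  rw [h.hull_eq]
  exact segment_subset_convexHull (by simp) (by simp)

theorem Triangulation.BoundaryTriple.mem_frontier_polygon {a b o : Plane}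
    (h : 𝒯.BoundaryTriple T a b o) : a ∈ frontier 𝒯.polygon ∧ b ∈ frontier 𝒯.polygon :=
  ⟨h.2.2.2.2.2 (left_mem_segment ℝ a b), h.2.2.2.2.2 (right_mem_segment ℝ a b)⟩

theorem Triangulation.BoundaryTriple.mem_frontier {a b o : Plane} (h : 𝒯.BoundaryTriple T a b o)
    (hfit : 𝒯.Fits Ω) : a ∈ frontier Ω ∧ b ∈ frontier Ω :=
  ⟨hfit.vertex_mem T h.1 a h.mem.1 h.mem_frontier_polygon.1,
    hfit.vertex_mem T h.1 b h.mem.2.1 h.mem_frontier_polygon.2⟩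

theorem dist_le_diam_hull {x y : Plane} (hx : x ∈ hull T) (hy : y ∈ hull T) :
    dist x y ≤ Metric.diam (hull T) :=
  Metric.dist_le_diam_of_mem (isCompact_hull T).isBounded hx hy

/-- Two boundary edges of a triangle of a fitted mesh agree up to orientation. -/
theorem boundaryTriple_unique (hfit : 𝒯.Fits Ω) {a b o a' b' o' : Plane}
    (h : 𝒯.BoundaryTriple T a b o) (h' : 𝒯.BoundaryTriple T a' b' o') :
    o' = o ∧ (a' = a ∧ b' = b ∨ a' = b ∧ b' = a) := by
  have ho : o' = o := hfit.one_edge T a' b' o' a b o h' h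
  subst ho
  refine ⟨rfl, ?_⟩
  have ha' : a' ∈ (T : Set Plane) := h'.mem.1
  have hb' : b' ∈ (T : Set Plane) := h'.mem.2.1
  rw [h.2.2.2.2.1] at ha' hb'
  have h1 := h'.2.1
  have h2 := h'.2.2.1
  have h3 := h'.2.2.2.1
  simp only [mem_insert_iff, mem_singleton_iff] at ha' hb'
  rcases ha' with rfl | rfl | rfl <;> rcases hb' with rfl | rfl | rfl <;> simp_all

theorem Triangulation.BoundaryTriple.joined {a b o : Plane} (h : 𝒯.BoundaryTriple T a b o)
    (hfit : 𝒯.Fits Ω) {δ C : ℝ} (hC : 0 < C) (hG : ∀ a ∈ frontier Ω, ∀ b ∈ frontier Ω, dist a b < δ →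
      JoinedNearChord (frontier Ω) a b (C * dist a b ^ 2)) (hδ : Metric.diam (hull T) < δ) :
    JoinedNearChord (frontier Ω) a b (C * Metric.diam (hull T) ^ 2) := by
  have hab : dist a b ≤ Metric.diam (hull T) :=
    dist_le_diam_hull (mem_hull h.mem.1) (mem_hull h.mem.2.1)
  refine (hG a (h.mem_frontier hfit).1 b (h.mem_frontier hfit).2 (hab.trans_lt hδ)).mono ?_
  gcongr

/-- The skin of a triangle lies close to its boundary edge. -/
theorem exists_dist_skin_le (hfit : 𝒯.Fits Ω) {δ C : ℝ} (hC : 0 < C)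
    (hG : ∀ a ∈ frontier Ω, ∀ b ∈ frontier Ω, dist a b < δ →
      JoinedNearChord (frontier Ω) a b (C * dist a b ^ 2)) (hδ : Metric.diam (hull T) < δ)
    {z : Plane} (hz : z ∈ 𝒯.skin Ω T) :
    ∃ x ∈ hull T ∩ frontier 𝒯.polygon, dist z x ≤ C * Metric.diam (hull T) ^ 2 := by
  obtain ⟨a, b, o, h, x, hx, y, hy, hz⟩ := hz
  refine ⟨x, ⟨h.segment_subset_hull hx, h.2.2.2.2.2 hx⟩, ?_⟩
  obtain ⟨P, hP, hxP⟩ := exists_perp_dist_le (h.joined hfit hC hG hδ) hx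
  rw [segment_eq_image_lineMap] at hz
  obtain ⟨t, ht, rfl⟩ := hz
  rw [dist_lineMap_left, Real.norm_eq_abs, abs_of_nonneg ht.1]
  have h1 := hy.2 P hP
  have h2 : 0 ≤ dist x y := dist_nonneg
  nlinarith [ht.2]

/-- A polynomial that vanishes at the boundary nodes of a triangle vanishes close to each of the
points that divide the boundary edge. -/
theorem exists_boundaryNode {k : ℕ} (hk : 2 ≤ k) (hfit : 𝒯.Fits Ω) {δ C s : ℝ} (hC : 0 < C)
    (hG : ∀ a ∈ frontier Ω, ∀ b ∈ frontier Ω, dist a b < δ →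
      JoinedNearChord (frontier Ω) a b (C * dist a b ^ 2)) (hδ : Metric.diam (hull T) < δ)
    {a b o : Plane} (h : 𝒯.BoundaryTriple T a b o) {c : Plane} {r : ℝ} (hr : 0 < r)
    (hc : Metric.closedBall c r ⊆ hull T) (hs : Metric.diam (hull T) ≤ s * (2 * r)) {j : ℕ}
    (hj : 1 ≤ j) (hj' : j ≤ k - 1) :
    ∃ P ∈ 𝒯.boundaryNodes k Ω T,
      dist (AffineMap.lineMap a b ((j : ℝ) / k)) P ≤ C * s * Metric.diam (hull T) ^ 2 := by
  have hkpos : (0 : ℝ) < k := by positivity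
  have ht : (j : ℝ) / k ∈ Icc (0 : ℝ) 1 := by
    refine ⟨by positivity, ?_⟩
    rw [div_le_one hkpos]
    exact_mod_cast (by omega : j ≤ k)
  obtain ⟨P₀, hP₀, hd⟩ := exists_mem_line_dist_le h.affineIndependent (h.joined hfit hC hG hδ) hr
    (hc.trans h.hull_eq.le) ht
  set M := AffineMap.lineMap a b ((j : ℝ) / k) with hM
  have hcl : IsClosed (frontier Ω ∩ (line[ℝ, o, M] : Set Plane)) :=
    isClosed_frontier.inter (AffineSubspace.closed_of_finiteDimensional _)
  obtain ⟨P, hP⟩ := exists_mem_nearestPts hcl M ⟨P₀, hP₀⟩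
  refine ⟨P, ⟨a, b, o, h, j, hj, hj', hP⟩, (hP.2 P₀ hP₀).trans (hd.trans ?_)⟩
  have hMT : M ∈ hull T := h.segment_subset_hull (by
    rw [segment_eq_image_lineMap]; exact ⟨_, ht, rfl⟩)
  have h1 := dist_le_diam_hull (mem_hull h.mem.2.2) hMT
  have hH : 0 ≤ Metric.diam (hull T) := Metric.diam_nonneg
  set H := Metric.diam (hull T)
  calc _ ≤ C * H ^ 2 / (2 * r) * (s * (2 * r)) := by
        gcongr; exact h1.trans hs
    _ = _ := by field_simp

/-- The data of the correction on the element `T`: `p` is the polynomial that defines `w` on `T`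
and on its skin, and `q` is a small polynomial that agrees with `p` on the boundary edge and
vanishes on the two other edges. -/
structure ElementCorrection (𝒯 : Triangulation) (k : ℕ) (Ω : Set Plane) (K : ℝ) (w : Plane → ℝ)
    (T : Finset Plane) (p q : MvPolynomial (Fin 2) ℝ) : Prop where
  degree_p : p.totalDegree ≤ k
  degree_q : q.totalDegree ≤ k
  eq_p : ∀ x ∈ hull T ∪ 𝒯.skin Ω T, w x = polyVal p x
  eq_edge : ∀ a b o, 𝒯.BoundaryTriple T a b o → (∀ x ∈ segment ℝ a b, polyVal q x = polyVal p x) ∧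
    (∀ x ∈ segment ℝ a o, polyVal q x = 0) ∧ ∀ x ∈ segment ℝ b o, polyVal q x = 0
  eq_zero : ¬ 𝒯.IsBoundary T → q = 0
  exists_ball : ∃ c r, 0 < r ∧ Metric.ball c r ⊆ hull T ∧ Metric.ball c r ⊆ closure Ω
  extension : ∃ B, IsCompact B ∧ hull T ∪ 𝒯.skin Ω T ⊆ B ∧
    ∫ x in B, ‖polyGrad p x‖ ^ 2 ≤ K * ∫ x in hull T, ‖polyGrad p x‖ ^ 2
  small : ∫ x in hull T, ‖polyGrad q x‖ ^ 2 ≤ 1 / 2 * ∫ x in hull T, ‖polyGrad p x‖ ^ 2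

theorem hull_subset_closedBall {c : Plane} {r : ℝ} (hr : 0 < r)
    (hc : Metric.closedBall c r ⊆ hull T) : hull T ⊆ Metric.closedBall c (Metric.diam (hull T)) :=
  fun _ hx => dist_le_diam_hull hx (hc (Metric.mem_closedBall_self hr.le))

theorem diam_hull_le_meshSize (hT : T ∈ 𝒯.elems) : Metric.diam (hull T) ≤ 𝒯.meshSize :=
  le_ciSup (f := fun T : 𝒯.elems => Metric.diam (hull T.1)) (Set.finite_range _).bddAbove ⟨T, hT⟩

theorem exists_elementCorrection {k : ℕ} (hk : 2 ≤ k) (hΩ : IsOpen Ω)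
    (hb : Bornology.IsBounded Ω) (hsm : HasCkBoundary k Ω) (σ : ℝ) :
    ∃ h₀ : ℝ, 0 < h₀ ∧ ∃ K : ℝ, 0 < K ∧ ∀ 𝒯 : Triangulation, 𝒯.Fits Ω → 𝒯.ShapeRegular σ →
      𝒯.meshSize ≤ h₀ → ∀ w ∈ 𝒯.spaceW k Ω, ∀ T ∈ 𝒯.elems,
        ∃ p q, ElementCorrection 𝒯 k Ω K w T p q := by
  obtain ⟨δ, hδ, C, hC, hG⟩ := exists_joinedNearChord hk hΩ hb hsm
  -- The given `σ` is arbitrary, possibly not positive; the larger bound `s` can be divided by.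
  set s := max σ 1 with hs
  have hs1 : 1 ≤ s := le_max_right _ _
  have hs0 : 0 < s := one_pos.trans_le hs1
  obtain ⟨K, hK, hKext⟩ := exists_setIntegral_closedBall_le k (R := 4 * s) (by positivity)
  obtain ⟨K₂, hK₂, hcorr⟩ := exists_small_edge_correction hk (s := s) (C := C * s) hs0
    (by positivity)
  -- `δ / 2` permits the chord estimate; `1 / (8 C s)` keeps nodes and skins close to the edge
  -- compared with `H` and `r`; the last two give `K₂ H² ≤ K₂ H ≤ 1 / 2`.
  refine ⟨min (δ / 2) (min (1 / (8 * C * s)) (min 1 (1 / (2 * K₂)))), by positivity, K, hK, ?_⟩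
  intro 𝒯 hfit hreg hmesh w hw T hT
  obtain ⟨hw1, hw2, hw3, hw4⟩ := hw
  obtain ⟨p, hp, hwp, hpn⟩ := hw4 T hT
  obtain ⟨c, r, hr, hc, hcr⟩ := hreg T hT
  have hHh := (diam_hull_le_meshSize hT).trans hmesh
  have hcH := hull_subset_closedBall hr hc
  set H := Metric.diam (hull T) with hH
  have hH0 : 0 ≤ H := Metric.diam_nonneg
  have hHs : H ≤ s * (2 * r) := hcr.trans (by gcongr; exact le_max_left _ _)
  have hHδ : H < δ := (hHh.trans (min_le_left _ _)).trans_lt (by linarith)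
  have hHC : 8 * (C * s * H) ≤ 1 := by
    have := hHh.trans ((min_le_right _ _).trans (min_le_left _ _))
    rw [le_div_iff₀ (by positivity)] at this
    linarith
  have hH1 : H ≤ 1 :=
    hHh.trans ((min_le_right _ _).trans ((min_le_right _ _).trans (min_le_left _ _)))
  have hHK : K₂ * H ^ 2 ≤ 1 / 2 := by
    have := hHh.trans ((min_le_right _ _).trans ((min_le_right _ _).trans (min_le_right _ _)))
    rw [le_div_iff₀ (by positivity)] at this
    nlinarith
  have hskin := fun z hz => exists_dist_skin_le (T := T) hfit hC hG hHδ (z := z) hz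
  have hCH : C * H ≤ C * s * H := by
    have := mul_nonneg hC.le hH0
    nlinarith
  have hCH2 : C * H ^ 2 ≤ H / 8 := by nlinarith
  have hCHr : C * H ^ 2 ≤ r / 4 := by
    calc C * H ^ 2 = C * H * H := by ring
      _ ≤ C * H * (s * (2 * r)) := by gcongr
      _ = (8 * (C * s * H)) * (r / 4) := by ring
      _ ≤ 1 * (r / 4) := by gcongr
      _ = _ := one_mul _
  have hext : ∃ B, IsCompact B ∧ hull T ∪ 𝒯.skin Ω T ⊆ B ∧
      ∫ x in B, ‖polyGrad p x‖ ^ 2 ≤ K * ∫ x in hull T, ‖polyGrad p x‖ ^ 2 := by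
    refine ⟨_, isCompact_closedBall c (4 * s * r), ?_, hKext p hp c r hr _ (isCompact_hull T) hc⟩
    rintro z (hz | hz)
    · exact Metric.closedBall_subset_closedBall (by nlinarith) (hcH hz)
    · obtain ⟨x, hx, hzx⟩ := hskin z hz
      have h1 := hcH hx.1
      rw [Metric.mem_closedBall] at h1 ⊢
      have := dist_triangle z x c
      nlinarith
  -- A skin point is within `r / 4` of the boundary of the polygon, whereas the disc of radius `r`
  -- is interior to it. Hence cutting off the skin leaves the half-size disc in the curved element,
  -- and so in `closure Ω`.
  have hdisj : ∀ z ∈ Metric.ball c (r / 2), z ∉ 𝒯.skin Ω T := by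
    intro z hz hzs
    obtain ⟨x, hx, hzx⟩ := hskin z hzs
    refine hx.2.2 (mem_interior.2 ⟨Metric.ball c r, ?_, Metric.isOpen_ball, ?_⟩)
    · exact (Metric.ball_subset_closedBall.trans hc).trans (hull_subset_polygon hT)
    · rw [Metric.mem_ball] at hz ⊢
      have := dist_triangle_left x c z
      linarith
  have hballT : Metric.ball c (r / 2) ⊆ hull T :=
    (Metric.ball_subset_ball (by linarith)).trans (Metric.ball_subset_closedBall.trans hc)
  have hball : ∃ c r, 0 < r ∧ Metric.ball c r ⊆ hull T ∧ Metric.ball c r ⊆ closure Ω := by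
    refine ⟨c, r / 2, by positivity, hballT, ?_⟩
    have hsub : 𝒯.curvedElem Ω T ⊆ closure Ω := by
      rw [← hfit.iUnion_curvedElem]
      exact subset_biUnion_of_mem (u := fun T => 𝒯.curvedElem Ω T) hT
    refine Subset.trans (fun z hz => ?_) hsub
    unfold Triangulation.curvedElem
    split_ifs
    · exact subset_closure ⟨hballT hz, hdisj z hz⟩
    · exact .inl (hballT hz)
    · exact hballT hz
  by_cases hbd : 𝒯.IsBoundary T
  · obtain ⟨a, b, o, h⟩ := hbd
    have hpv : ∀ x ∈ T, x ∈ frontier 𝒯.polygon → polyVal p x = 0 := fun x hx hx' => by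
      rw [← hwp x (.inl (mem_hull hx)), hw2 T hT x hx hx']
    have hpa := hpv a h.mem.1 h.mem_frontier_polygon.1
    have hpb := hpv b h.mem.2.1 h.mem_frontier_polygon.2
    obtain ⟨q, hq, hq1, hq2, hq3, hq4⟩ := hcorr a b o h.affineIndependent c r H hr hH0
      (by linarith) (by linarith [mul_nonneg (mul_nonneg hC.le hs0.le) hH0])
      (hc.trans h.hull_eq.le) (h.hull_eq ▸ hcH) p hp hpa hpb (fun j hj hj' => by
        obtain ⟨P, hP, hd⟩ := exists_boundaryNode hk hfit hC hG hHδ h hr hc hHs hj hj'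
        exact ⟨P, hpn P hP, hd⟩)
    refine ⟨p, q, hp, hq, hwp, ?_, fun hn => absurd ⟨a, b, o, h⟩ hn, hball, hext, ?_⟩
    · intro a' b' o' h'
      obtain ⟨rfl, ⟨rfl, rfl⟩ | ⟨rfl, rfl⟩⟩ := boundaryTriple_unique hfit h h'
      · exact ⟨hq1, hq2, hq3⟩
      · exact ⟨by rwa [segment_symm], hq3, hq2⟩
    · rw [h.hull_eq]
      refine hq4.trans ?_
      have : 0 ≤ ∫ x in convexHull ℝ {a, b, o}, ‖polyGrad p x‖ ^ 2 :=
        integral_nonneg fun _ => by positivity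
      gcongr
  · refine ⟨p, 0, hp, by simp, hwp, fun a b o h => absurd ⟨a, b, o, h⟩ hbd, fun _ => rfl, hball,
      hext, ?_⟩
    have h1 : 0 ≤ ∫ x in hull T, ‖polyGrad p x‖ ^ 2 := integral_nonneg fun _ => by positivity
    have h2 : ∀ x, polyGrad 0 x = 0 := fun x => by ext i; simp
    simp only [h2]
    simp
    linarith

end Elements

/-! ### Gradients of piecewise polynomial functions. -/

section Gradients

/-- Almost everywhere where `f` agrees with a polynomial and is differentiable, the gradients
agree. -/
theorem ae_gradient_eq (f : Plane → ℝ) (p : MvPolynomial (Fin 2) ℝ) :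
    ∀ᵐ x : Plane, DifferentiableAt ℝ f x → f x = polyVal p x → gradient f x = polyGrad p x := by
  let g : Plane → ℝ := fun x => f x - polyVal p x
  let S : Set Plane := g ⁻¹' {0} ∩ {x | DifferentiableAt ℝ g x}
  have hS : MeasurableSet S := by
    have hc : ContinuousOn g {x | DifferentiableAt ℝ g x} :=
      fun x hx => hx.continuousAt.continuousWithinAt
    obtain ⟨u, hu, hu'⟩ := continuousOn_iff_isClosed.1 hc {0} isClosed_singleton
    rw [show S = u ∩ {x | DifferentiableAt ℝ g x} from hu']
    exact hu.measurableSet.inter (measurableSet_of_differentiableAt ℝ g)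
  let e : Plane := EuclideanSpace.single 0 1
  have he : e ≠ 0 := by simp [e]
  have happ : ApproximatesLinearOn (fun x => g x • e) (0 : Plane →L[ℝ] Plane) S 0 := by
    intro x hx y hy
    have h1 : g x = 0 := hx.1
    have h2 : g y = 0 := hy.1
    simp [h1, h2]
  have key := happ.norm_fderiv_sub_le volume hS (fun x => (fderiv ℝ g x).smulRight e)
    (fun x hx => (hx.2.hasFDerivAt.smul_const e).hasFDerivWithinAt)
  rw [ae_restrict_iff' hS] at key
  filter_upwards [key] with x hx hd hfx
  have hdg : DifferentiableAt ℝ g x := hd.sub (differentiable_polyVal p x)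
  have h1 : fderiv ℝ g x = 0 := by
    have := hx ⟨by simp [g, hfx], hdg⟩
    simpa [he] using this
  have h2 : fderiv ℝ g x = fderiv ℝ f x - fderiv ℝ (polyVal p) x :=
    fderiv_fun_sub hd (differentiable_polyVal p x)
  rw [← gradient_polyVal]
  unfold gradient
  rw [sub_eq_zero.1 (h2.symm.trans h1)]

theorem measurable_gradient (f : Plane → ℝ) : Measurable (gradient f) :=
  (InnerProductSpace.toDual ℝ Plane).symm.continuous.measurable.comp (measurable_fderiv ℝ f)

theorem gradient_eq_of_mem_interior {f : Plane → ℝ} {p : MvPolynomial (Fin 2) ℝ} {D : Set Plane}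
    (h : ∀ x ∈ D, f x = polyVal p x) {x : Plane} (hx : x ∈ interior D) :
    gradient f x = polyGrad p x := by
  rw [← gradient_polyVal]
  refine Filter.EventuallyEq.gradient_eq ?_
  filter_upwards [isOpen_interior.mem_nhds hx] with y hy using h y (interior_subset hy)

theorem ae_mem_interior_hull (T : Finset Plane) :
    ∀ᵐ x ∂(volume.restrict (hull T)), x ∈ interior (hull T) := by
  rw [ae_restrict_iff' (isClosed_hull T).measurableSet]
  have h0 : volume (frontier (hull T)) = 0 := (convex_convexHull ℝ _).addHaar_frontier volume
  filter_upwards [measure_eq_zero_iff_ae_notMem.1 h0] with x hx hxT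
  by_contra hxi
  exact hx ⟨subset_closure hxT, hxi⟩

theorem ae_gradient_eq_on_hull {f : Plane → ℝ} {p : MvPolynomial (Fin 2) ℝ} {T : Finset Plane}
    (h : ∀ x ∈ hull T, f x = polyVal p x) :
    ∀ᵐ x ∂(volume.restrict (hull T)), gradient f x = polyGrad p x := by
  filter_upwards [ae_mem_interior_hull T] with x hx using gradient_eq_of_mem_interior h hx

/-- The integral of `|∇f|²` for a function given by polynomials on the sets `D T` and vanishing
elsewhere. -/
theorem setIntegral_gradient_sq_le {f : Plane → ℝ} (E : Finset (Finset Plane))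
    {D B : Finset Plane → Set Plane} {P : Finset Plane → MvPolynomial (Fin 2) ℝ}
    (hf : ∀ x, (∀ T ∈ E, x ∉ D T) → f x = 0) (hP : ∀ T ∈ E, ∀ x ∈ D T, f x = polyVal (P T) x)
    (hB : ∀ T ∈ E, IsCompact (B T)) (hDB : ∀ T ∈ E, D T ⊆ B T) (Ω : Set Plane) :
    IntegrableOn (fun x => ‖gradient f x‖ ^ 2) Ω ∧
      ∫ x in Ω, ‖gradient f x‖ ^ 2 ≤ ∑ T ∈ E, ∫ x in B T, ‖polyGrad (P T) x‖ ^ 2 := by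
  -- The sets `D T` may overlap, so the squared gradient is dominated by a sum over all elements.
  -- Where `f` is not differentiable, `gradient f` has the default value 0 and the bound is trivial.
  let F : Plane → ℝ := fun x => ∑ T ∈ E, (B T).indicator (fun x => ‖polyGrad (P T) x‖ ^ 2) x
  have hint : ∀ T ∈ E, Integrable ((B T).indicator (fun x => ‖polyGrad (P T) x‖ ^ 2)) := fun T hT =>
    (integrable_indicator_iff (hB T hT).measurableSet).2
      (integrableOn_norm_polyGrad_sq _ (hB T hT))
  have hF : Integrable F := integrable_finsetSum _ hint
  have hF0 : ∀ x, 0 ≤ F x := fun x =>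
    Finset.sum_nonneg fun T _ => indicator_nonneg (fun _ _ => by positivity) x
  have hle : ∀ᵐ x : Plane, ‖gradient f x‖ ^ 2 ≤ F x := by
    have h1 : ∀ᵐ x : Plane, ∀ T ∈ E, DifferentiableAt ℝ f x → f x = polyVal (P T) x →
        gradient f x = polyGrad (P T) x :=
      (E.eventually_all).2 fun T _ => ae_gradient_eq f (P T)
    filter_upwards [h1, ae_gradient_eq f 0] with x hx hx0
    by_cases hd : DifferentiableAt ℝ f x
    · by_cases hmem : ∃ T ∈ E, x ∈ D T
      · obtain ⟨T, hT, hxT⟩ := hmem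
        rw [hx T hT hd (hP T hT x hxT)]
        have h2 : (B T).indicator (fun x => ‖polyGrad (P T) x‖ ^ 2) x = ‖polyGrad (P T) x‖ ^ 2 :=
          indicator_of_mem (hDB T hT hxT) _
        rw [← h2]
        exact Finset.single_le_sum
          (f := fun T => (B T).indicator (fun x => ‖polyGrad (P T) x‖ ^ 2) x)
          (fun T _ => indicator_nonneg (fun _ _ => by positivity) x) hT
      · push Not at hmem
        have h3 : polyGrad 0 x = 0 := by ext i; simp
        rw [hx0 hd (by rw [hf x hmem]; simp), h3]
        simpa using hF0 x
    · rw [gradient_eq_zero_of_not_differentiableAt hd]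
      simpa using hF0 x
  have hI : Integrable (fun x => ‖gradient f x‖ ^ 2) := by
    refine hF.mono' ((measurable_gradient f).norm.pow_const 2).aestronglyMeasurable ?_
    filter_upwards [hle] with x hx
    rwa [Real.norm_of_nonneg (by positivity)]
  refine ⟨hI.integrableOn, ?_⟩
  calc _ ≤ ∫ x, ‖gradient f x‖ ^ 2 :=
        setIntegral_le_integral hI (Filter.Eventually.of_forall fun x => by positivity)
    _ ≤ ∫ x, F x := integral_mono_ae hI hF hle
    _ = _ := by
        rw [integral_finsetSum _ hint]
        exact Finset.sum_congr rfl fun T hT => integral_indicator (hB T hT).measurableSet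

theorem polyGrad_eq_zero_of_open {p : MvPolynomial (Fin 2) ℝ} {U : Set Plane} (hU : IsOpen U)
    (hne : U.Nonempty) (h : ∀ᵐ x ∂(volume.restrict U), polyGrad p x = 0) (x : Plane) :
    polyGrad p x = 0 := by
  have h1 : EqOn (polyGrad p) (fun _ => 0) U := Measure.eqOn_open_of_ae_eq h hU
    (continuous_polyGrad p).continuousOn continuousOn_const
  obtain ⟨y, hy⟩ := hne
  obtain ⟨ε, hε, hεU⟩ := Metric.isOpen_iff.1 hU y hy
  ext i
  have h2 : MvPolynomial.pderiv i p = 0 := eq_zero_of_polyVal_eq_zero_on_ball hε fun z hz => by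
    have := congrArg (fun v : Plane => v i) (h1 (hεU hz))
    simpa using this
  simp [h2]

theorem polyGrad_eq_zero_of_integral {p : MvPolynomial (Fin 2) ℝ} {D : Set Plane}
    (hD : IsCompact D) {c : Plane} {r : ℝ} (hr : 0 < r) (hc : Metric.ball c r ⊆ D)
    (h : ∫ x in D, ‖polyGrad p x‖ ^ 2 ≤ 0) (x : Plane) : polyGrad p x = 0 := by
  have h0 : ∫ x in D, ‖polyGrad p x‖ ^ 2 = 0 :=
    h.antisymm (integral_nonneg fun _ => by positivity)
  rw [setIntegral_eq_zero_iff_of_nonneg_ae (Filter.Eventually.of_forall fun _ => by positivity)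
    (integrableOn_norm_polyGrad_sq p hD)] at h0
  refine polyGrad_eq_zero_of_open Metric.isOpen_ball ⟨c, Metric.mem_ball_self hr⟩ ?_ x
  filter_upwards [ae_restrict_of_ae_restrict_of_subset hc h0] with y hy
  simpa using hy

/-- A disc in `closure Ω` meets the open set `Ω` in a nonempty open set, on which a nonconstant
polynomial cannot have zero gradient almost everywhere. -/
theorem gradNorm_pos {Ω : Set Plane} (hΩ : IsOpen Ω) {f : Plane → ℝ}
    (hf : IntegrableOn (fun x => ‖gradient f x‖ ^ 2) Ω) {p : MvPolynomial (Fin 2) ℝ} {c : Plane}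
    {r : ℝ} (hr : 0 < r) (hc : Metric.ball c r ⊆ closure Ω)
    (hp : ∀ x ∈ Metric.ball c r, f x = polyVal p x) (hne : ¬ ∀ x, polyGrad p x = 0) :
    0 < gradNorm Ω f := by
  unfold gradNorm
  refine Real.sqrt_pos.2 ((integral_nonneg fun _ => by positivity).lt_of_ne' fun h0 => hne ?_)
  rw [setIntegral_eq_zero_iff_of_nonneg_ae (Filter.Eventually.of_forall fun _ => by positivity)
    hf] at h0
  have hU : IsOpen (Metric.ball c r ∩ Ω) := Metric.isOpen_ball.inter hΩ
  have hUne : (Metric.ball c r ∩ Ω).Nonempty :=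
    mem_closure_iff.1 (hc (Metric.mem_ball_self hr)) _ Metric.isOpen_ball
      (Metric.mem_ball_self hr)
  refine polyGrad_eq_zero_of_open hU hUne ?_
  filter_upwards [ae_restrict_of_ae_restrict_of_subset inter_subset_right h0,
    ae_restrict_mem hU.measurableSet] with x hx hxU
  have h1 : gradient f x = polyGrad p x :=
    gradient_eq_of_mem_interior hp (by rw [Metric.isOpen_ball.interior_eq]; exact hxU.1)
  rw [← h1]
  simpa using hx

theorem polyVal_eq_of_polyGrad_eq_zero {p : MvPolynomial (Fin 2) ℝ} (h : ∀ x, polyGrad p x = 0)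
    (x y : Plane) : polyVal p x = polyVal p y := by
  refine is_const_of_fderiv_eq_zero (𝕜 := ℝ) (differentiable_polyVal p) (fun z => ?_) x y
  rw [(hasGradientAt_polyVal p z).hasFDerivAt.fderiv, h z, map_zero]

end Gradients

/-! ### Integrals over the polygon as sums over triangles. -/

section MeshIntegrals

variable {𝒯 : Triangulation}

/-- At an interior point all three barycentric coordinates are positive, so all three vertices are
shared. -/
theorem eq_of_mem_interior_hull {T T' : Finset Plane} (hT : T ∈ 𝒯.elems) (hT' : T' ∈ 𝒯.elems)
    {x : Plane} (hx : x ∈ interior (hull T)) (hx' : x ∈ hull T') : T = T' := by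
  obtain ⟨a, b, o, hab, hao, hbo, hTeq⟩ := exists_triple hT
  have h := affineIndependent_triple hT hab hao hbo hTeq
  have hxT := interior_subset hx
  unfold hull at hx
  rw [hTeq, mem_interior_convexHull_triple h] at hx
  refine Finset.eq_of_subset_of_card_le (fun z hz => ?_)
    (by rw [𝒯.card_eq T hT, 𝒯.card_eq T' hT'])
  rw [← Finset.mem_coe, hTeq, ← range_triple] at hz
  obtain ⟨i, rfl⟩ := hz
  exact mem_of_mem_hull_inter hT hTeq h hT' hxT hx' i (hx i)

theorem setIntegral_polygon {f : Plane → ℝ} (hf : ∀ T ∈ 𝒯.elems, IntegrableOn f (hull T)) :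
    ∫ x in 𝒯.polygon, f x = ∑ T ∈ 𝒯.elems, ∫ x in hull T, f x := by
  have hU : 𝒯.polygon = ⋃ T : 𝒯.elems, hull T.1 := by
    ext x
    simp [Triangulation.polygon]
  have hd : Pairwise (Function.onFun (AEDisjoint volume) fun T : 𝒯.elems => hull T.1) := by
    intro T T' hne
    refine measure_mono_null (t := frontier (hull T.1)) ?_
      ((convex_convexHull ℝ _).addHaar_frontier volume)
    rintro x ⟨hx, hx'⟩
    exact ⟨subset_closure hx, fun hxi =>
      hne (Subtype.ext (eq_of_mem_interior_hull T.2 T'.2 hxi hx'))⟩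
  have hi : IntegrableOn f (⋃ T : 𝒯.elems, hull T.1) :=
    integrableOn_finite_iUnion.2 fun T => hf T.1 T.2
  have h := integral_iUnion_ae
    (fun T : 𝒯.elems => (isClosed_hull T.1).measurableSet.nullMeasurableSet) hd hi
  rw [hU, h, tsum_fintype]
  exact Finset.sum_coe_sort 𝒯.elems fun T => ∫ x in hull T, f x

end MeshIntegrals

/-! ### Gluing the corrections and the inf-sup estimate. -/

section InfSup

variable {𝒯 : Triangulation} {T : Finset Plane} {Ω : Set Plane} {k : ℕ} {K : ℝ} {w : Plane → ℝ}

theorem ElementCorrection.polyVal_eq_zero_of_mem {p q : MvPolynomial (Fin 2) ℝ}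
    (hc : ElementCorrection 𝒯 k Ω K w T p q) {x : Plane} (hx : x ∈ T) : polyVal q x = 0 := by
  by_cases hb : 𝒯.IsBoundary T
  · obtain ⟨a, b, o, h⟩ := hb
    obtain ⟨-, h2, h3⟩ := hc.eq_edge a b o h
    rw [← Finset.mem_coe, h.2.2.2.2.1] at hx
    rcases hx with rfl | rfl | rfl
    · exact h2 _ (left_mem_segment ℝ _ _)
    · exact h3 _ (left_mem_segment ℝ _ _)
    · exact h2 _ (right_mem_segment ℝ _ _)
  · rw [hc.eq_zero hb, polyVal_zero]

open Classical in
/-- The values of the correction on the edges of a triangle. -/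
theorem ElementCorrection.polyVal_edge {p q : MvPolynomial (Fin 2) ℝ}
    (hc : ElementCorrection 𝒯 k Ω K w T p q) (hT : T ∈ 𝒯.elems)
    (hw : ∀ a ∈ T, a ∈ frontier 𝒯.polygon → w a = 0) {x : Plane}
    (hx : x ∈ hull T) (hxi : x ∉ interior (hull T)) :
    polyVal q x = if x ∈ frontier 𝒯.polygon then w x else 0 := by
  split_ifs with hxf
  · rcases mem_or_mem_boundary_segment hT hx hxf with hxT | ⟨a, b, o, h, hxab⟩
    · rw [hc.polyVal_eq_zero_of_mem hxT, hw x hxT hxf]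
    · rw [(hc.eq_edge a b o h).1 x hxab, hc.eq_p x (.inl hx)]
  · by_cases hb : 𝒯.IsBoundary T
    · obtain ⟨a, b, o, h⟩ := hb
      obtain ⟨-, h2, h3⟩ := hc.eq_edge a b o h
      rw [h.hull_eq] at hx hxi
      rcases mem_openSegment_of_notMem_interior h.affineIndependent hx hxi with h1 | h1 | h1 | h1
      · rw [← h.2.2.2.2.1] at h1
        exact hc.polyVal_eq_zero_of_mem h1
      · exact absurd (h.2.2.2.2.2 (openSegment_subset_segment _ _ _ h1)) hxf
      · exact h2 x (openSegment_subset_segment _ _ _ h1)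
      · exact h3 x (openSegment_subset_segment _ _ _ h1)
    · rw [hc.eq_zero hb, polyVal_zero]

theorem continuous_of_piecewise {v : Plane → ℝ} (hc : ContinuousOn v 𝒯.polygon)
    (hf : ∀ x ∈ frontier 𝒯.polygon, v x = 0) (h0 : ∀ x ∉ 𝒯.polygon, v x = 0) : Continuous v := by
  have h1 : v = 𝒯.polygon.indicator v := by
    ext x
    by_cases hx : x ∈ 𝒯.polygon
    · simp [hx]
    · simp [hx, h0 x hx]
  rw [h1]
  exact continuous_indicator hf (by rwa [isCompact_polygon.isClosed.closure_eq])

/-- A function of `V_h` whose gradient vanishes is zero. -/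
theorem eq_zero_of_polyGrad_eq_zero {v : Plane → ℝ} (hv : v ∈ 𝒯.spaceV k)
    {P : Finset Plane → MvPolynomial (Fin 2) ℝ}
    (hP : ∀ T ∈ 𝒯.elems, ∀ x ∈ hull T, v x = polyVal (P T) x)
    (hg : ∀ T ∈ 𝒯.elems, ∀ x, polyGrad (P T) x = 0) : v = 0 := by
  have hcont : Continuous v := continuous_of_piecewise hv.1 hv.2.1 hv.2.2.1
  -- A continuous function on the plane with finitely many values is constant, and `v` is zero
  -- outside the bounded polygon.
  have hfin : (range v).Finite := by
    refine ((𝒯.elems.finite_toSet.image fun T => polyVal (P T) 0).insert 0).subset ?_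
    rintro _ ⟨x, rfl⟩
    by_cases hx : x ∈ 𝒯.polygon
    · obtain ⟨T, hT, hxT⟩ := mem_iUnion₂.1 hx
      exact .inr ⟨T, hT, by
        rw [hP T hT x hxT]; exact polyVal_eq_of_polyGrad_eq_zero (hg T hT) _ _⟩
    · exact .inl (hv.2.2.1 x hx)
  have hsub : (range v).Subsingleton :=
    hfin.countable.isTotallyDisconnected _ Subset.rfl (isPreconnected_range hcont)
  obtain ⟨y, hy⟩ := (ne_univ_iff_exists_notMem _).1 (isCompact_polygon (𝒯 := 𝒯)).ne_univ
  ext x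
  rw [Pi.zero_apply, ← hv.2.2.1 y hy]
  exact hsub (mem_range_self x) (mem_range_self y)

/-- The corrected function belongs to `V_h`. -/
theorem exists_spaceV_of_correction (hw : w ∈ 𝒯.spaceW k Ω)
    {p q : Finset Plane → MvPolynomial (Fin 2) ℝ}
    (hc : ∀ T ∈ 𝒯.elems, ElementCorrection 𝒯 k Ω K w T (p T) (q T)) :
    ∃ v ∈ 𝒯.spaceV k, ∀ T ∈ 𝒯.elems, ∀ x ∈ hull T, v x = polyVal (p T - q T) x := by
  classical
  let v : Plane → ℝ := fun x => if h : ∃ T ∈ 𝒯.elems, x ∈ hull T then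
    polyVal (p h.choose - q h.choose) x else 0
  -- On the boundary of `T` the value of `q T` depends only on the point and not on `T`. Hence the
  -- polynomials `p T - q T` agree on common edges, and they vanish on `Γ_h`.
  have hedge : ∀ T ∈ 𝒯.elems, ∀ x ∈ hull T, x ∉ interior (hull T) →
      polyVal (q T) x = if x ∈ frontier 𝒯.polygon then w x else 0 := fun T hT x hx hxi =>
    (hc T hT).polyVal_edge hT (hw.2.1 T hT) hx hxi
  have hv : ∀ T ∈ 𝒯.elems, ∀ x ∈ hull T, v x = polyVal (p T - q T) x := by
    intro T hT x hx
    have hex : ∃ T ∈ 𝒯.elems, x ∈ hull T := ⟨T, hT, hx⟩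
    have hv1 : v x = polyVal (p hex.choose - q hex.choose) x := dif_pos hex
    obtain ⟨hT', hx'⟩ := hex.choose_spec
    rw [hv1]
    generalize hex.choose = T' at *
    by_cases hTT : T = T'
    · rw [hTT]
    · rw [polyVal_sub, polyVal_sub, ← (hc T hT).eq_p x (.inl hx),
        ← (hc T' hT').eq_p x (.inl hx'),
        hedge T hT x hx fun hi => hTT (eq_of_mem_interior_hull hT hT' hi hx'),
        hedge T' hT' x hx' fun hi => hTT (eq_of_mem_interior_hull hT' hT hi hx).symm]
  refine ⟨v, ⟨?_, fun x hx => ?_, fun x hx => ?_, fun T hT => ⟨p T - q T, ?_, hv T hT⟩⟩, hv⟩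
  · have hU : 𝒯.polygon = ⋃ T : 𝒯.elems, hull T.1 := by
      ext x; simp [Triangulation.polygon]
    rw [hU]
    exact (locallyFinite_of_finite _).continuousOn_iUnion (fun T => isClosed_hull T.1)
      fun T => (continuous_polyVal _).continuousOn.congr (hv T.1 T.2)
  · obtain ⟨T, hT, hxT⟩ := mem_iUnion₂.1 (isCompact_polygon.isClosed.frontier_subset hx)
    have hxi : x ∉ interior (hull T) := fun hi =>
      hx.2 (interior_mono (hull_subset_polygon hT) hi)
    rw [hv T hT x hxT, polyVal_sub, hedge T hT x hxT hxi, if_pos hx,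
      (hc T hT).eq_p x (.inl hxT), sub_self]
  · refine dif_neg ?_
    rintro ⟨T, hT, hxT⟩
    exact hx (hull_subset_polygon hT hxT)
  · exact (MvPolynomial.totalDegree_sub _ _).trans
      (max_le (hc T hT).degree_p (hc T hT).degree_q)

theorem ElementCorrection.le_inner {p q : MvPolynomial (Fin 2) ℝ}
    (hc : ElementCorrection 𝒯 k Ω K w T p q) :
    1 / 4 * ∫ x in hull T, ‖polyGrad p x‖ ^ 2 ≤
      ∫ x in hull T, inner ℝ (polyGrad p x) (polyGrad (p - q) x) := by
  have hp := integrableOn_norm_polyGrad_sq p (isCompact_hull T)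
  have hq := integrableOn_norm_polyGrad_sq q (isCompact_hull T)
  have hi : IntegrableOn (fun x => inner ℝ (polyGrad p x) (polyGrad (p - q) x)) (hull T) :=
    ((continuous_polyGrad p).inner (continuous_polyGrad _)).continuousOn.integrableOn_compact
      (isCompact_hull T)
  -- Young's inequality `∇p · ∇q ≤ (|∇p|² + |∇q|²) / 2`; with `small` the result is `1/2 - 1/4 =
  -- 1/4`.
  have h1 : ∫ x in hull T, (1 / 2 * ‖polyGrad p x‖ ^ 2 - 1 / 2 * ‖polyGrad q x‖ ^ 2) ≤
      ∫ x in hull T, inner ℝ (polyGrad p x) (polyGrad (p - q) x) := by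
    refine integral_mono ((hp.const_mul _).sub (hq.const_mul _)) hi fun x => ?_
    simp only [polyGrad_sub, inner_sub_right, real_inner_self_eq_norm_sq]
    nlinarith [real_inner_le_norm (polyGrad p x) (polyGrad q x),
      sq_nonneg (‖polyGrad p x‖ - ‖polyGrad q x‖)]
  rw [integral_sub (hp.const_mul _) (hq.const_mul _), integral_const_mul,
    integral_const_mul] at h1
  linarith [hc.small]

theorem ElementCorrection.norm_le {p q : MvPolynomial (Fin 2) ℝ}
    (hc : ElementCorrection 𝒯 k Ω K w T p q) :
    ∫ x in hull T, ‖polyGrad (p - q) x‖ ^ 2 ≤ 3 * ∫ x in hull T, ‖polyGrad p x‖ ^ 2 := by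
  have hp := integrableOn_norm_polyGrad_sq p (isCompact_hull T)
  have hq := integrableOn_norm_polyGrad_sq q (isCompact_hull T)
  have h1 : ∫ x in hull T, ‖polyGrad (p - q) x‖ ^ 2 ≤
      ∫ x in hull T, (2 * ‖polyGrad p x‖ ^ 2 + 2 * ‖polyGrad q x‖ ^ 2) := by
    refine integral_mono (integrableOn_norm_polyGrad_sq _ (isCompact_hull T))
      ((hp.const_mul _).add (hq.const_mul _)) fun x => ?_
    simp only [polyGrad_sub]
    have := parallelogram_law_with_norm ℝ (polyGrad p x) (polyGrad q x)
    nlinarith [sq_nonneg ‖polyGrad p x + polyGrad q x‖]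
  rw [integral_add (hp.const_mul _) (hq.const_mul _), integral_const_mul,
    integral_const_mul] at h1
  linarith [hc.small]

/-- On some element, neither the function nor its correction has vanishing gradient. -/
theorem exists_polyGrad_ne_zero (hw : w ∈ 𝒯.spaceW k Ω) (hw0 : w ≠ 0)
    {p q : Finset Plane → MvPolynomial (Fin 2) ℝ}
    (hc : ∀ T ∈ 𝒯.elems, ElementCorrection 𝒯 k Ω K w T (p T) (q T)) {v : Plane → ℝ}
    (hv : v ∈ 𝒯.spaceV k) (hvp : ∀ T ∈ 𝒯.elems, ∀ x ∈ hull T, v x = polyVal (p T - q T) x) :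
    ∃ T ∈ 𝒯.elems, (¬ ∀ x, polyGrad (p T - q T) x = 0) ∧ ¬ ∀ x, polyGrad (p T) x = 0 := by
  have hpq : ∃ T ∈ 𝒯.elems, ¬ ∀ x, polyGrad (p T - q T) x = 0 := by
    by_contra! hg
    have hv0 : v = 0 := eq_zero_of_polyGrad_eq_zero hv hvp hg
    have hp0 : ∀ T ∈ 𝒯.elems, ∀ x, polyVal (p T) x = 0 := by
      intro T hT
      obtain ⟨c, r, hr, hcT, -⟩ := (hc T hT).exists_ball
      -- If `v = 0` then `p = q`, so `small` bounds `∫ |∇p|²` by half of itself. Thus `p` is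
      -- constant, and its value is that of `q` at a vertex, namely 0.
      have heq : p T = q T := by
        rw [← sub_eq_zero]
        refine eq_zero_of_polyVal_eq_zero_on_ball (c := c) hr fun x hx => ?_
        rw [← hvp T hT x (hcT hx), hv0, Pi.zero_apply]
      have hsmall := (hc T hT).small
      rw [← heq] at hsmall
      have hgp := polyGrad_eq_zero_of_integral (isCompact_hull T) hr hcT
        (p := p T) (by linarith)
      obtain ⟨a, b, o, -, -, -, hTeq⟩ := exists_triple hT
      have ha : a ∈ T := by rw [← Finset.mem_coe, hTeq]; simp
      intro x
      rw [polyVal_eq_of_polyGrad_eq_zero hgp x a, heq, (hc T hT).polyVal_eq_zero_of_mem ha]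
    refine hw0 (funext fun x => ?_)
    by_cases hx : ∃ T ∈ 𝒯.elems, x ∈ hull T ∪ 𝒯.skin Ω T
    · obtain ⟨T, hT, hxT⟩ := hx
      rw [(hc T hT).eq_p x hxT, hp0 T hT, Pi.zero_apply]
    · push Not at hx
      exact hw.2.2.1 x hx
  obtain ⟨T, hT, hne⟩ := hpq
  refine ⟨T, hT, hne, fun hp0 => hne fun x => ?_⟩
  obtain ⟨c, r, hr, hcT, -⟩ := (hc T hT).exists_ball
  have hsmall := (hc T hT).small
  simp only [hp0, norm_zero] at hsmall
  rw [polyGrad_sub, hp0 x, polyGrad_eq_zero_of_integral (isCompact_hull T) hr hcT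
    (hsmall.trans (by simp)) x, sub_zero]

theorem inf_sup_of_correction (hΩ : IsOpen Ω) (hK : 0 < K) (hw : w ∈ 𝒯.spaceW k Ω) (hw0 : w ≠ 0)
    {p q : Finset Plane → MvPolynomial (Fin 2) ℝ}
    (hc : ∀ T ∈ 𝒯.elems, ElementCorrection 𝒯 k Ω K w T (p T) (q T)) :
    ∃ v ∈ 𝒯.spaceV k, v ≠ 0 ∧
      1 / (4 * (Real.sqrt K * Real.sqrt 3)) ≤ 𝒯.form w v / (gradNorm Ω w * gradNorm Ω v) := by
  obtain ⟨v, hv, hvp⟩ := exists_spaceV_of_correction hw hc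
  obtain ⟨T₀, hT₀, hgv, hgw⟩ := exists_polyGrad_ne_zero hw hw0 hc hv hvp
  obtain ⟨c, r, hr, hcT, hcΩ⟩ := (hc T₀ hT₀).exists_ball
  choose! B hB hDB hBA using fun T hT => (hc T hT).extension
  set A : Finset Plane → ℝ := fun T => ∫ x in hull T, ‖polyGrad (p T) x‖ ^ 2 with hA
  have hA0 : ∀ T, 0 ≤ A T := fun T => integral_nonneg fun _ => by positivity
  have hApos : 0 < ∑ T ∈ 𝒯.elems, A T := by
    refine Finset.sum_pos' (fun T _ => hA0 T) ⟨T₀, hT₀, ?_⟩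
    by_contra! hle
    exact hgw (polyGrad_eq_zero_of_integral (isCompact_hull T₀) hr hcT hle)
  obtain ⟨hwi, hwle⟩ := setIntegral_gradient_sq_le (f := w) 𝒯.elems (P := p) (B := B)
    (D := fun T => hull T ∪ 𝒯.skin Ω T) (fun x hx => hw.2.2.1 x hx)
    (fun T hT => (hc T hT).eq_p) hB hDB Ω
  obtain ⟨hvi, hvle⟩ := setIntegral_gradient_sq_le (f := v) 𝒯.elems (P := fun T => p T - q T)
    (B := fun T => hull T) (D := fun T => hull T)
    (fun x hx => hv.2.2.1 x fun hxp => by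
      obtain ⟨T, hT, hxT⟩ := mem_iUnion₂.1 hxp
      exact hx T hT hxT) hvp (fun T _ => isCompact_hull T) (fun T _ => Subset.rfl) Ω
  -- Both norms must be positive, since a quotient by zero has the value 0 and would not satisfy the
  -- bound.
  have hwpos : 0 < gradNorm Ω w := gradNorm_pos hΩ hwi hr hcΩ
    (fun x hx => (hc T₀ hT₀).eq_p x (.inl (hcT hx))) hgw
  have hvpos : 0 < gradNorm Ω v := gradNorm_pos hΩ hvi hr hcΩ
    (fun x hx => hvp T₀ hT₀ x (hcT hx)) hgv
  have hwN : gradNorm Ω w ≤ Real.sqrt (K * ∑ T ∈ 𝒯.elems, A T) := by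
    refine Real.sqrt_le_sqrt (hwle.trans ?_)
    rw [Finset.mul_sum]
    exact Finset.sum_le_sum hBA
  have hvN : gradNorm Ω v ≤ Real.sqrt (3 * ∑ T ∈ 𝒯.elems, A T) := by
    refine Real.sqrt_le_sqrt (hvle.trans ?_)
    rw [Finset.mul_sum]
    exact Finset.sum_le_sum fun T hT => (hc T hT).norm_le
  have hform : 1 / 4 * ∑ T ∈ 𝒯.elems, A T ≤ 𝒯.form w v := by
    have hae : ∀ T ∈ 𝒯.elems, (fun x => inner ℝ (gradient w x) (gradient v x))
        =ᵐ[volume.restrict (hull T)]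
        fun x => inner ℝ (polyGrad (p T) x) (polyGrad (p T - q T) x) := by
      intro T hT
      filter_upwards [ae_gradient_eq_on_hull fun x hx => (hc T hT).eq_p x (.inl hx),
        ae_gradient_eq_on_hull (hvp T hT)] with x h1 h2
      rw [h1, h2]
    have hi : ∀ T ∈ 𝒯.elems, IntegrableOn (fun x => inner ℝ (gradient w x) (gradient v x))
        (hull T) := fun T hT =>
      (((continuous_polyGrad (p T)).inner
        (continuous_polyGrad (p T - q T))).continuousOn.integrableOn_compact
          (isCompact_hull T)).congr (hae T hT).symm
    unfold Triangulation.form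
    rw [setIntegral_polygon hi, Finset.mul_sum]
    refine Finset.sum_le_sum fun T hT => ?_
    rw [integral_congr_ae (hae T hT)]
    exact (hc T hT).le_inner
  refine ⟨v, hv, fun h0 => ?_, ?_⟩
  · rw [h0] at hvpos
    have hz : gradient (0 : Plane → ℝ) = 0 := by
      ext1 x
      exact gradient_fun_const x 0
    simp [gradNorm, hz] at hvpos
  · rw [div_le_div_iff₀ (by positivity) (mul_pos hwpos hvpos), one_mul]
    have hS := hApos.le
    set S := ∑ T ∈ 𝒯.elems, A T
    rw [Real.sqrt_mul hK.le] at hwN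
    rw [Real.sqrt_mul zero_le_three] at hvN
    calc gradNorm Ω w * gradNorm Ω v ≤ (√K * √S) * (√3 * √S) := by gcongr
      _ = 1 / 4 * S * (4 * (√K * √3)) := by
          have := Real.mul_self_sqrt hS
          linear_combination (√K * √3) * this
      _ ≤ _ := by gcongr

end InfSup

end CurvedFEM

end

theorem corollary2p1 (k : ℕ) (hk : 2 ≤ k) (Ω : Set CurvedFEM.Plane)
    (hΩ_open : IsOpen Ω) (hΩ_conn : IsConnected Ω) (hΩ_bdd : Bornology.IsBounded Ω)
    (hΩ_smooth : CurvedFEM.HasCkBoundary k Ω) (σ : ℝ) :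
    ∃ h₀ : ℝ, 0 < h₀ ∧ ∃ α : ℝ, 0 < α ∧
      ∀ 𝒯 : CurvedFEM.Triangulation, 𝒯.Fits Ω → 𝒯.ShapeRegular σ → 𝒯.meshSize ≤ h₀ →
        ∀ w ∈ 𝒯.spaceW k Ω, w ≠ 0 →
          (α : EReal) ≤ ⨆ v ∈ {v : CurvedFEM.Plane → ℝ | v ∈ 𝒯.spaceV k ∧ v ≠ 0},
            ((𝒯.form w v / (CurvedFEM.gradNorm Ω w * CurvedFEM.gradNorm Ω v) : ℝ) : EReal) := by
  obtain ⟨h₀, hh₀, K, hK, h⟩ :=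
    CurvedFEM.exists_elementCorrection hk hΩ_open hΩ_bdd hΩ_smooth σ
  refine ⟨h₀, hh₀, 1 / (4 * (Real.sqrt K * Real.sqrt 3)), by positivity, ?_⟩
  intro 𝒯 hfit hreg hmesh w hw hw0
  choose! p q hc using h 𝒯 hfit hreg hmesh w hw
  obtain ⟨v, hv, hv0, hle⟩ := CurvedFEM.inf_sup_of_correction hΩ_open hK hw hw0 hc
  exact le_iSup₂_of_le v ⟨hv, hv0⟩ (EReal.coe_le_coe hle)
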